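/- **Algorithms.** Let $m,n,r,L,T\ge 0$ and $k\ge 1$ be integers, $W^0\in\mathbb R^{m\times n}$, $\eta\in\mathbb R$, $\sigma\ge 0$, $C>0$, $q_c,q_s\in[0,1]$, and let $\ell(A,B,z)$ be a loss that is differentiable in $(A,B)\in\mathbb R^{r\times n}\times\mathbb R^{m\times r}$ for every sample $z$. Orthonormalization is by Gram–Schmidt (dependent vectors become $0$). *PowerDP.* On input $W\in\mathbb R^{m\times n}$: draw $Q\in\mathbb R^{r\times n}$ with i.i.d. $\mathcal N(0,1)$ entries; repeat $k$ times: $P\gets WQ^{\top}$, orthonormalize the columns of $P$, $A\gets P^{\top}W$, $Q\gets A$ with rows orthonormalized. Then set $\tilde B\gets WQ^{\top}+G_B$ and $\tilde A\gets A+G_A$, where $G_A,G_B$ are independent with i.i.d. $\mathcal N(0,\sigma^2C^2)$ entries; orthonormalize the rows of $\tilde A$; return $(\tilde A,\tilde B)$. *FedPower.* The dataset consists of $N$ clients, client $i$ holding a finite local dataset $D_i$. Let $A^0$ have i.i.d. $\mathcal N(0,\sigma^2)$ entries and $B^0=0$. In each global round $t=1,\dots,T$: every client is sampled independently with probability $q_c$,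 giving $\mathcal C^t$. Each sampled client $i$ starts from $(A^{t-1},B^{t-1})$ and performs $L$ simultaneous gradient steps of step size $\eta$ in $A$ and $B$ on the average loss over a random batch (each sample of $D_i$ included independently with probability $q_s$, afresh in each step; an empty batch causes no change), ending with $(A_i,B_i)$. Its update $\Delta W_i=B_iA_i$ is clipped to $\Delta W_i/\max(1,\|\Delta W_i\|_F/C)$. Let $\Delta W^t$ be the average of the clipped updates over $i\in\mathcal C^t$ ($0$ if $\mathcal C^t=\emptyset$), and $(A^t,B^t)=\mathrm{PowerDP}(\Delta W^t)$. All random draws are independent. The output is $W^T=W^0+B^TA^T$, where $T$ is the round index. **Client-level privacy.** Two datasets are client-adjacent if one arises from the other by removing one client together with its entire local dataset. A mechanism $\mathcal M$ is client-level $(\epsilon,\delta)$-DP if $\Pr[\mathcal M(D)\in S]\le e^{\epsilon}\Pr[\mathcal M(D')\in S]+\delta$ for all client-adjacent $D,D'$ and all measurable sets $S$ of outputs. **Theorem (Client-Level DP of FedPower).** For every $\delta_0<1$ there is a constant $c>0$, depending on nothing but $\delta_0$ (so an absolute constant once, say, $\delta_0=1/2$ is fixed), such that for all parameters and losses as above,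 all $0<\epsilon<c\,q_c^2\,T$ and all $0<\delta\le\delta_0$, FedPower is client-level $(\epsilon,\delta)$-DP whenever $$\sigma\ \ge\ c\,\frac{q_c\sqrt{T\log(1/\delta)}}{\epsilon}.$$ -/

import Mathlib

open MeasureTheory ProbabilityTheory

noncomputable section

namespace FedPower

/-! ### Differential privacy -/

/-- A randomized mechanism `M` (a probability law on the outputs `R` for every dataset) is
`(ε, δ)`-differentially private with respect to the adjacency relation `adj`. -/
def IsDP {𝒟 R : Type*} [MeasurableSpace R] (adj : 𝒟 → 𝒟 → Prop) (M : 𝒟 → Measure R)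
    (ε δ : ℝ) : Prop :=
  (∀ D, IsProbabilityMeasure (M D)) ∧
    ∀ D D', adj D D' → ∀ S : Set R, MeasurableSet S →
      M D S ≤ ENNReal.ofReal (Real.exp ε) * M D' S + ENNReal.ofReal δ

/-- A distributed dataset: `N` clients, client `i` holding the finite local dataset `data i`. -/
structure FedDataset (Z : Type*) where
  N : ℕ
  data : Fin N → List Z

/-- `D` arises from `D'` by the addition of one client, holding the whole local dataset `d`. -/
def AddsClient {Z : Type*} (D D' : FedDataset Z) : Prop :=
  ∃ (N : ℕ) (E : Fin N → List Z) (i : Fin (N + 1)) (d : List Z),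
    D' = ⟨N, E⟩ ∧ D = ⟨N + 1, i.insertNth (α := fun _ => List Z) d E⟩

/-- Client-adjacency: the addition or the removal of a single client's entire local dataset. -/
def ClientAdjacent {Z : Type*} (D D' : FedDataset Z) : Prop :=
  AddsClient D D' ∨ AddsClient D' D

/-- Client-level `(ε, δ)`-differential privacy. -/
def IsClientLevelDP {Z R : Type*} [MeasurableSpace R] (M : FedDataset Z → Measure R)
    (ε δ : ℝ) : Prop :=
  IsDP ClientAdjacent M ε δ

/-! ### Matrices -/

/-- Real `m × n` matrices. -/
abbrev Mat (m n : ℕ) := Matrix (Fin m) (Fin n) ℝ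

/-- The (Borel) product `σ`-algebra on the entries. -/
instance instMeasurableSpaceMat (m n : ℕ) : MeasurableSpace (Mat m n) :=
  inferInstanceAs (MeasurableSpace (Fin m → Fin n → ℝ))

/-- Frobenius norm. -/
def frobNorm {m n : ℕ} (W : Mat m n) : ℝ := √(∑ i, ∑ j, W i j ^ 2)

/-- Clipping to Frobenius norm at most `C`: `W / max(1, ‖W‖_F / C)`. -/
def clip {m n : ℕ} (C : ℝ) (W : Mat m n) : Mat m n := (max 1 (frobNorm W / C))⁻¹ • W

/-- Gram-Schmidt orthonormalization of the rows (a row that depends linearly on the preceding ones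
is replaced by zero). -/
def orthRows {m n : ℕ} (M : Mat m n) : Mat m n :=
  Matrix.of fun i j =>
    InnerProductSpace.gramSchmidtNormed ℝ
      (fun i : Fin m => (WithLp.toLp 2 (M i) : EuclideanSpace ℝ (Fin n))) i j

/-- Gram-Schmidt orthonormalization of the columns. -/
def orthCols {m n : ℕ} (M : Mat m n) : Mat m n := (orthRows M.transpose).transpose

/-- The law of a random matrix with independent `𝒩(0, s²)` entries. -/
def gaussianMatrix (m n : ℕ) (s : ℝ) : Measure (Mat m n) :=
  (Measure.pi fun _ : Fin m => Measure.pi fun _ : Fin n => gaussianReal 0 (s ^ 2).toNNReal).map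
    Matrix.of

/-! ### PowerDP -/

/-- One subspace iteration on the pair `(A, Q)`:
`P ← W Qᵀ`, `P ← orthonormalize columns of P`, `A ← Pᵀ W`, `Q ← orthonormalize rows of A`. -/
def powerStep {m n r : ℕ} (W : Mat m n) (s : Mat r n × Mat r n) : Mat r n × Mat r n :=
  let P := orthCols (W * s.2.transpose)
  let A := P.transpose * W
  (A, orthRows A)

/-- The pair `(A, Q)` after `k` iterations from the initial `Q₀`. (`A` is only assigned by the
iteration; its initial value `0` is irrelevant as soon as `1 ≤ k`.) -/
def powerLoop {m n r : ℕ} (W : Mat m n) (k : ℕ) (Q₀ : Mat r n) : Mat r n × Mat r n :=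
  (powerStep W)^[k] (0, Q₀)

/-- The output `(Ã, B̃)` of PowerDP on `W`, given the random initialization `Q₀` and the noise
matrices `GB`, `GA` that are added to `W Qᵀ` and to `A`. -/
def powerDP {m n r : ℕ} (W : Mat m n) (k : ℕ) (Q₀ : Mat r n) (GB : Mat m r) (GA : Mat r n) :
    Mat r n × Mat m r :=
  let AQ := powerLoop W k Q₀
  (orthRows (AQ.1 + GA), W * AQ.2.transpose + GB)

/-! ### FedPower -/

/-- The inputs of FedPower. The loss `ℓ A B z` is the loss on sample `z` of the model with the
LoRA modules `A`, `B`. -/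
structure Input (m n r : ℕ) (Z : Type*) where
  /-- number of global rounds -/
  T : ℕ
  /-- number of local rounds -/
  L : ℕ
  /-- number of power iterations -/
  k : ℕ
  /-- global weight -/
  W₀ : Mat m n
  /-- learning rate -/
  η : ℝ
  /-- noise scale -/
  σ : ℝ
  /-- clipping threshold -/
  C : ℝ
  /-- client sampling rate -/
  qc : unitInterval
  /-- sample sampling rate -/
  qs : unitInterval
  /-- loss function -/
  ℓ : Mat r n → Mat m r → Z → ℝ

/-- The entrywise gradient (with respect to the Frobenius inner product) of `f` at `X`. -/
def matGrad {m n : ℕ} (f : Mat m n → ℝ) (X : Mat m n) : Mat m n :=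
  Matrix.of fun i j => lineDeriv ℝ f X (Matrix.single i j 1)

/-- Average loss over the batch `{j | b j = true}` of the local dataset `d`. -/
def batchLoss {m n r : ℕ} {Z : Type*} (ℓ : Mat r n → Mat m r → Z → ℝ) (d : List Z)
    (b : Fin d.length → Bool) (A : Mat r n) (B : Mat m r) : ℝ :=
  (∑ j with b j = true, ℓ A B (d.get j)) / (Finset.univ.filter fun j => b j = true).card

/-- One local gradient step on the batch `b`; `A` and `B` are updated simultaneously. -/
def localStep {m n r : ℕ} {Z : Type*} (I : Input m n r Z) (d : List Z)
    (b : Fin d.length → Bool) (s : Mat r n × Mat m r) : Mat r n × Mat m r :=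
  (s.1 - I.η • matGrad (fun A => batchLoss I.ℓ d b A s.2) s.1,
   s.2 - I.η • matGrad (fun B => batchLoss I.ℓ d b s.1 B) s.2)

/-- The `L` local rounds of a client with local dataset `d`, on the batches `b 0, b 1, …`. -/
def localTrain {m n r : ℕ} {Z : Type*} (I : Input m n r Z) (d : List Z)
    (b : Fin I.L → Fin d.length → Bool) (s : Mat r n × Mat m r) : Mat r n × Mat m r :=
  Fin.foldl I.L (fun s l => localStep I d (b l) s) s

/-- The clipped full-rank update `ΔW = B A` of a client. -/
def clientUpdate {m n r : ℕ} {Z : Type*} (I : Input m n r Z) (d : List Z)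
    (b : Fin I.L → Fin d.length → Bool) (s : Mat r n × Mat m r) : Mat m n :=
  clip I.C ((localTrain I d b s).2 * (localTrain I d b s).1)

/-- The batch indicators of all clients in one global round: `β i l j = true` if sample `j` of
client `i` is in the batch of local round `l`. -/
abbrev Batches {Z : Type*} (L : ℕ) (D : FedDataset Z) : Type :=
  (i : Fin D.N) → Fin L → Fin (D.data i).length → Bool

/-- The average of the clipped updates over the sampled clients `{i | c i = true}`; it is zero if no
client is sampled. -/
def aggregate {m n r : ℕ} {Z : Type*} (I : Input m n r Z) (D : FedDataset Z)
    (c : Fin D.N → Bool) (β : Batches I.L D) (s : Mat r n × Mat m r) : Mat m n :=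
  ((Finset.univ.filter fun i => c i = true).card : ℝ)⁻¹ •
    ∑ i with c i = true, clientUpdate I (D.data i) (β i) s

/-- The randomness of one global round: sampled clients, batches, initialization of PowerDP, and
the two noise matrices of PowerDP. -/
abbrev RoundRand {Z : Type*} (m n r L : ℕ) (D : FedDataset Z) : Type :=
  (Fin D.N → Bool) × Batches L D × Mat r n × Mat m r × Mat r n

/-- Its law: all parts are independent; each client is sampled with probability `qc`, each sample of
a batch with probability `qs`; the initialization is standard Gaussian, and the noise is Gaussian
of standard deviation `σ C`. -/
def roundLaw {m n r : ℕ} {Z : Type*} (I : Input m n r Z) (D : FedDataset Z) :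
    Measure (RoundRand m n r I.L D) :=
  (Measure.pi fun _ : Fin D.N => bernoulliMeasure true false I.qc).prod
    ((Measure.pi fun i : Fin D.N => Measure.pi fun _ : Fin I.L =>
        Measure.pi fun _ : Fin (D.data i).length => bernoulliMeasure true false I.qs).prod
      ((gaussianMatrix r n 1).prod
        ((gaussianMatrix m r (I.σ * I.C)).prod (gaussianMatrix r n (I.σ * I.C)))))

/-- One global round: the new LoRA modules, from the old ones and the randomness of the round. -/
def globalRound {m n r : ℕ} {Z : Type*} (I : Input m n r Z) (D : FedDataset Z)
    (s : Mat r n × Mat m r) (ω : RoundRand m n r I.L D) : Mat r n × Mat m r :=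
  powerDP (aggregate I D ω.1 ω.2.1 s) I.k ω.2.2.1 ω.2.2.2.1 ω.2.2.2.2

/-- The joint law of the LoRA modules `(Aᵗ, Bᵗ)` after `t` rounds; each round uses fresh
independent randomness. Initially `A⁰` has independent `𝒩(0, σ²)` entries and `B⁰ = 0`. -/
def stateLaw {m n r : ℕ} {Z : Type*} (I : Input m n r Z) (D : FedDataset Z) :
    ℕ → Measure (Mat r n × Mat m r)
  | 0 => (gaussianMatrix r n I.σ).prod (Measure.dirac 0)
  | t + 1 => ((stateLaw I D t).prod (roundLaw I D)).map fun p => globalRound I D p.1 p.2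

/-- The FedPower mechanism: the law of the released weights `W⁰ + B A`, where `(A, B)` are the
LoRA modules after the last round. -/
def mechanism {m n r : ℕ} {Z : Type*} (I : Input m n r Z) (D : FedDataset Z) : Measure (Mat m n) :=
  (stateLaw I D I.T).map fun s => I.W₀ + s.2 * s.1

/-- The loss of each sample is a differentiable function of the pair of LoRA modules. -/
def DifferentiableLoss {m n r : ℕ} {Z : Type*} (ℓ : Mat r n → Mat m r → Z → ℝ) : Prop :=
  ∀ z, Differentiable ℝ fun p : (Fin r → Fin n → ℝ) × (Fin m → Fin r → ℝ) =>
    ℓ (Matrix.of p.1) (Matrix.of p.2) z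

end FedPower

end

/-!
The proof bounds Rényi divergences and composes them, in a dual form (`HolderDom`): the density
`dP/dQ` has `Lˡ(Q)` norm at most `a` precisely when `∫ f dP ≤ a (∫ fᵖ dQ)^{1/p}` for all `f ≥ 0`,
where `1/p + 1/l = 1`. Stability under post-processing, mixtures and adaptive composition is then
immediate, and Young's inequality gives `(ε, δ)`-privacy (`HolderDom.measure_le`).

*One call of PowerDP.* Before the noise is added, both matrices computed by PowerDP have Frobenius
norm at most `C`, by Bessel's inequality for the Gram-Schmidt vectors. So any two inputs, adjacent
or not, yield Gaussian laws whose means differ by at most `√8 C`, with noise `σ C`: the likelihood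
ratio `R` has moments `E Rᵃ = e^{θ a (a - 1)}` with `θ ≤ 4 / σ²` (`exists_shift_powerDPLaw`).

*One subsampled round.* Removing a client changes the round only if this client is sampled.
Conditionally on the rest of the randomness, the round with the client is therefore the mixture
`(1 - q) Q + q Q₁`, where `Q` is the law of the round without it (`roundKernel_eq_bind`). Its
density `1 - q + q R` has `l`-th moment at most `e^{O(q² l² θ)}` under `Q` as long as `θ l` is
small, and so does, for `q < 1`, its inverse under the mixture (`lintegral_mix_pow_mul_le`,
`lintegral_mix_inv_pow_le`). No relation between `q` and `σ` is needed here.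

*The constant.* Let `L = log (1/δ)`, which is at least a positive `L₀` depending on `δ₀`, and
`K = c² q² T`. The hypotheses say that `c ε < K` and `K L ≤ σ² ε²`. The order is
`l = 2 + ⌈2 L / ε⌉`. If `K ≥ 64`, the noise is so large that the last call of PowerDP alone hides
everything, and neither composition nor subsampling is needed (`stateLaw_succ_le_of_gaussian`).
If `K < 64`, then `q < 1`, `ε ≤ L` and `θ l` is small, so the bounds for the `T` subsampled rounds
compose to `e^{O(T q² l² / σ²)}`, which fits into the budget (`stateLaw_le_of_subsampling`).
-/

noncomputable section

open scoped ENNReal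

namespace FedPower

/-! ### Hölder domination of measures -/

/-- The dual form of a bound on the Rényi divergence of `P` from `Q`: if `l` is the exponent
conjugate to `p`, this says that `P` has a density with respect to `Q` whose `Lˡ(Q)` norm is at
most `a`. Stated in this way, it needs no density, and is visibly stable under maps, mixtures and
adaptive composition. -/
def HolderDom {Ω : Type*} [MeasurableSpace Ω] (p : ℝ) (a : ℝ≥0∞) (P Q : Measure Ω) : Prop :=
  ∀ f : Ω → ℝ≥0∞, Measurable f → ∫⁻ x, f x ∂P ≤ a * (∫⁻ x, f x ^ p ∂Q) ^ (1 / p)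

namespace HolderDom

variable {Ω Ω' : Type*} [MeasurableSpace Ω] [MeasurableSpace Ω'] {p l : ℝ} {a b : ℝ≥0∞}

lemma mono {P Q : Measure Ω} (h : HolderDom p a P Q) (hab : a ≤ b) : HolderDom p b P Q :=
  fun f hf => (h f hf).trans (by gcongr)

lemma refl (hpl : p.HolderConjugate l) (P : Measure Ω) [IsProbabilityMeasure P] :
    HolderDom p 1 P P := by
  intro f hf
  have := ENNReal.lintegral_mul_le_Lp_mul_Lq P hpl hf.aemeasurable
    (g := fun _ => 1) aemeasurable_const
  simpa using this

lemma map {P Q : Measure Ω} (h : HolderDom p a P Q) {g : Ω → Ω'} (hg : Measurable g) :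
    HolderDom p a (P.map g) (Q.map g) := by
  intro f hf
  rw [lintegral_map hf hg, lintegral_map (hf.pow_const p) hg]
  exact h _ (hf.comp hg)

/-- Adaptive composition. -/
lemma bind (hp : 0 < p) {P Q : Measure Ω} {K K' : Ω → Measure Ω'} (h : HolderDom p a P Q)
    (hK : Measurable K) (hK' : Measurable K') (hb : ∀ s, HolderDom p b (K s) (K' s)) :
    HolderDom p (b * a) (P.bind K) (Q.bind K') := by
  intro f hf
  have hm : Measurable fun s => ∫⁻ y, f y ^ p ∂K' s :=
    (Measure.measurable_lintegral (hf.pow_const p)).comp hK'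
  rw [Measure.lintegral_bind hK.aemeasurable hf.aemeasurable,
    Measure.lintegral_bind hK'.aemeasurable (hf.pow_const p).aemeasurable]
  calc ∫⁻ s, ∫⁻ y, f y ∂K s ∂P
      ≤ ∫⁻ s, b * (∫⁻ y, f y ^ p ∂K' s) ^ (1 / p) ∂P := lintegral_mono fun s => hb s f hf
    _ = b * ∫⁻ s, (∫⁻ y, f y ^ p ∂K' s) ^ (1 / p) ∂P := lintegral_const_mul _ (hm.pow_const _)
    _ ≤ b * (a * (∫⁻ s, ((∫⁻ y, f y ^ p ∂K' s) ^ (1 / p)) ^ p ∂Q) ^ (1 / p)) := by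
        gcongr
        exact h _ (hm.pow_const _)
    _ = _ := by
        simp_rw [← ENNReal.rpow_mul, one_div_mul_cancel hp.ne', ENNReal.rpow_one, mul_assoc]

lemma withDensity (hpl : p.HolderConjugate l) {Q : Measure Ω} {r : Ω → ℝ≥0∞} (hr : Measurable r)
    (h : ∫⁻ x, r x ^ l ∂Q ≤ a ^ l) : HolderDom p a (Q.withDensity r) Q := by
  intro f hf
  rw [lintegral_withDensity_eq_lintegral_mul _ hr hf]
  refine (ENNReal.lintegral_mul_le_Lp_mul_Lq Q hpl.symm hr.aemeasurable hf.aemeasurable).trans ?_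
  gcongr
  calc (∫⁻ x, r x ^ l ∂Q) ^ (1 / l) ≤ (a ^ l) ^ (1 / l) := by
        gcongr
        exact one_div_nonneg.2 hpl.symm.nonneg
    _ = a := by rw [← ENNReal.rpow_mul, mul_one_div_cancel hpl.symm.ne_zero, ENNReal.rpow_one]

/-- Young's inequality turns Hölder domination into an `(ε, δ)` bound. -/
lemma measure_le (hpl : p.HolderConjugate l) {P Q : Measure Ω} {b ε δ : ℝ} (hδ : 0 < δ)
    (h : HolderDom p (ENNReal.ofReal (Real.exp b)) P Q)
    (hb : b * l + Real.log (1 / δ) ≤ ε * (l - 1)) {S : Set Ω} (hS : MeasurableSet S) :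
    P S ≤ ENNReal.ofReal (Real.exp ε) * Q S + ENNReal.ofReal δ := by
  have h1 := h (S.indicator 1) (measurable_one.indicator hS)
  have h2 : ∀ x, (S.indicator (1 : Ω → ℝ≥0∞) x) ^ p = S.indicator 1 x := by
    intro x
    by_cases hx : x ∈ S <;> simp [hx, hpl.pos]
  simp_rw [h2, lintegral_indicator_one hS] at h1
  set e := ENNReal.ofReal (Real.exp ε)
  have hyoung := ENNReal.young_inequality ((e * Q S) ^ (1 / p))
    (ENNReal.ofReal (Real.exp (b - ε / p))) hpl
  have hle : ∀ (x : ℝ≥0∞) {t : ℝ}, 1 < t → x / ENNReal.ofReal t ≤ x := fun x t ht =>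
    ENNReal.div_le_of_le_mul' (le_mul_of_one_le_left (zero_le) (by simpa using ht.le))
  have hsplit : ENNReal.ofReal (Real.exp b) * Q S ^ (1 / p) =
      (e * Q S) ^ (1 / p) * ENNReal.ofReal (Real.exp (b - ε / p)) := by
    rw [ENNReal.mul_rpow_of_nonneg _ _ (one_div_nonneg.2 hpl.nonneg),
      ENNReal.ofReal_rpow_of_pos (Real.exp_pos _), ← Real.exp_mul, mul_right_comm,
      ← ENNReal.ofReal_mul (Real.exp_pos _).le, ← Real.exp_add]
    congr 3
    ring
  rw [hsplit] at h1
  refine h1.trans (hyoung.trans (add_le_add ((hle _ hpl.lt).trans_eq ?_)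
    ((hle _ hpl.symm.lt).trans ?_)))
  · rw [← ENNReal.rpow_mul, one_div_mul_cancel hpl.ne_zero, ENNReal.rpow_one]
  · rw [ENNReal.ofReal_rpow_of_pos (Real.exp_pos _), ← Real.exp_mul]
    apply ENNReal.ofReal_le_ofReal
    rw [← Real.le_log_iff_exp_le hδ]
    have : l / p = l - 1 := hpl.symm.div_conj_eq_sub_one
    rw [one_div, Real.log_inv] at hb
    calc (b - ε / p) * l = b * l - ε * (l / p) := by ring
      _ ≤ _ := by rw [this]; linarith

end HolderDom

/-! ### Likelihood ratios with log-normal moments -/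

/-- `Q₁` has a density `e^X` with respect to `Q` whose moments are those of the likelihood ratio of
two Gaussian measures with the same covariance. The parameter `θ` is half the squared distance of
the means, in units of the standard deviation. -/
def IsLogNormalShift {Ω : Type*} [MeasurableSpace Ω] (θ : ℝ) (Q Q₁ : Measure Ω) : Prop :=
  ∃ X : Ω → ℝ, Measurable X ∧ Q₁ = Q.withDensity (fun x => ENNReal.ofReal (Real.exp (X x))) ∧
    ∀ a : ℝ, ∫⁻ x, ENNReal.ofReal (Real.exp (a * X x)) ∂Q =
      ENNReal.ofReal (Real.exp (θ * (a * (a - 1))))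

/-- The mixture `(1 - q) Q + q Q₁`. -/
def mix {Ω : Type*} [MeasurableSpace Ω] (q : ℝ) (Q Q₁ : Measure Ω) : Measure Ω :=
  ENNReal.ofReal (1 - q) • Q + ENNReal.ofReal q • Q₁

lemma mix_map {Ω Ω' : Type*} [MeasurableSpace Ω] [MeasurableSpace Ω'] (q : ℝ) (Q Q₁ : Measure Ω)
    {g : Ω → Ω'} (hg : Measurable g) : mix q (Q.map g) (Q₁.map g) = (mix q Q Q₁).map g := by
  simp [mix, Measure.map_add _ _ hg]

lemma mix_withDensity {Ω : Type*} [MeasurableSpace Ω] {q : ℝ} (hq0 : 0 ≤ q) (hq1 : q ≤ 1)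
    (Q : Measure Ω) {X : Ω → ℝ} (hX : Measurable X) :
    mix q Q (Q.withDensity fun x => ENNReal.ofReal (Real.exp (X x))) =
      Q.withDensity fun x => ENNReal.ofReal (1 - q + q * Real.exp (X x)) := by
  have hm : Measurable fun x => ENNReal.ofReal (Real.exp (X x)) := by fun_prop
  have : (fun x => ENNReal.ofReal (1 - q + q * Real.exp (X x))) =
      (fun _ => ENNReal.ofReal (1 - q)) +
        (ENNReal.ofReal q) • fun x => ENNReal.ofReal (Real.exp (X x)) := by
    funext x
    simp only [Pi.add_apply, Pi.smul_apply, smul_eq_mul]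
    rw [ENNReal.ofReal_add (by linarith) (by positivity), ENNReal.ofReal_mul hq0]
  rw [this, withDensity_add_left measurable_const, withDensity_const, withDensity_smul _ hm, mix]

section Moments

variable {Ω : Type*} [MeasurableSpace Ω] {θ q : ℝ} {Q : Measure Ω} {X : Ω → ℝ}

/-- The mixed moments of the likelihood ratio `R = e^X` and of the ratio `1 - q + q R` of the
subsampled mechanism. Passing from `i` to `i + 1` replaces a bound `B(j)` by
`(1 - q) B(j) + q B(j + 1)`, and as long as `4 θ (i + j) ≤ 1` this costs a factor
`1 + q (e^x - 1)` with `x ≤ 1`, which is at most `e^{2 q x}`; this is where the gain `q²` of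
subsampling comes from. -/
lemma lintegral_mix_pow_mul_le (hX : Measurable X)
    (hmom : ∀ a : ℝ, ∫⁻ x, ENNReal.ofReal (Real.exp (a * X x)) ∂Q =
      ENNReal.ofReal (Real.exp (θ * (a * (a - 1)))))
    (hθ : 0 ≤ θ) (hq0 : 0 ≤ q) (hq1 : q ≤ 1) (i j : ℕ) (hij : 4 * θ * (i + j) ≤ 1) :
    ∫⁻ x, ENNReal.ofReal ((1 - q + q * Real.exp (X x)) ^ i * Real.exp (j * X x)) ∂Q ≤
      ENNReal.ofReal (Real.exp (θ * (j * (j - 1)) + 4 * q * θ * i * j + 4 * q ^ 2 * θ * i ^ 2)) := by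
  induction i generalizing j with
  | zero => simp [hmom]
  | succ i ih =>
    push_cast at hij
    have hpos : ∀ x, 0 ≤ 1 - q + q * Real.exp (X x) := fun x => by
      have := Real.exp_pos (X x)
      nlinarith
    have hm : ∀ j : ℕ, Measurable fun x =>
        ENNReal.ofReal ((1 - q + q * Real.exp (X x)) ^ i * Real.exp (j * X x)) := fun j => by
      fun_prop
    have hsplit : ∀ x, ENNReal.ofReal
        ((1 - q + q * Real.exp (X x)) ^ (i + 1) * Real.exp (j * X x)) =
        ENNReal.ofReal (1 - q) *
          ENNReal.ofReal ((1 - q + q * Real.exp (X x)) ^ i * Real.exp (j * X x)) +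
        ENNReal.ofReal q *
          ENNReal.ofReal ((1 - q + q * Real.exp (X x)) ^ i * Real.exp ((j + 1 : ℕ) * X x)) := by
      intro x
      have h0 := pow_nonneg (hpos x) i
      rw [← ENNReal.ofReal_mul (by linarith), ← ENNReal.ofReal_mul hq0,
        ← ENNReal.ofReal_add (mul_nonneg (by linarith) (by positivity)) (by positivity)]
      congr 1
      push_cast
      rw [add_mul, one_mul, Real.exp_add]
      ring
    simp_rw [hsplit]
    rw [lintegral_add_left ((hm j).const_mul _), lintegral_const_mul _ (hm j),
      lintegral_const_mul _ (hm (j + 1))]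
    have h1 := ih j (by nlinarith)
    have h2 := ih (j + 1) (by push_cast; linarith)
    refine (add_le_add (mul_le_mul_right h1 _) (mul_le_mul_right h2 _)).trans ?_
    rw [← ENNReal.ofReal_mul (by linarith), ← ENNReal.ofReal_mul hq0,
      ← ENNReal.ofReal_add (mul_nonneg (by linarith) (Real.exp_pos _).le) (by positivity)]
    apply ENNReal.ofReal_le_ofReal
    set E := θ * (j * (j - 1)) + 4 * q * θ * i * j + 4 * q ^ 2 * θ * i ^ 2 with hE
    set x := 2 * θ * j + 4 * q * θ * i with hx
    have hi : (0 : ℝ) ≤ i := i.cast_nonneg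
    have hj : (0 : ℝ) ≤ j := j.cast_nonneg
    have hx0 : 0 ≤ x := by positivity
    have hx1 : x ≤ 1 := by
      have : q * (θ * i) ≤ 1 * (θ * i) := by gcongr
      nlinarith [mul_nonneg hθ hj, mul_nonneg hθ hi]
    have hexp : Real.exp x ≤ 1 + 2 * x := by
      have := Real.abs_exp_sub_one_le (x := x) (by rwa [abs_of_nonneg hx0])
      rw [abs_of_nonneg hx0] at this
      linarith [le_abs_self (Real.exp x - 1)]
    have heq : θ * (((j + 1 : ℕ) : ℝ) * ((j + 1 : ℕ) - 1)) + 4 * q * θ * i * (j + 1 : ℕ) +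
        4 * q ^ 2 * θ * i ^ 2 = E + x := by
      push_cast
      rw [hE, hx]
      ring
    rw [heq, Real.exp_add E x]
    calc (1 - q) * Real.exp E + q * (Real.exp E * Real.exp x)
        = Real.exp E * (1 + q * (Real.exp x - 1)) := by ring
      _ ≤ Real.exp E * (2 * q * x + 1) := by
          have := mul_le_mul_of_nonneg_left hexp hq0
          refine mul_le_mul_of_nonneg_left ?_ (Real.exp_pos _).le
          linarith
      _ ≤ Real.exp E * Real.exp (2 * q * x) := by
          gcongr
          exact Real.add_one_le_exp _
      _ ≤ _ := by
          rw [← Real.exp_add]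
          apply Real.exp_le_exp.2
          rw [hE, hx]
          push_cast
          nlinarith [mul_nonneg (sq_nonneg q) hθ]

/-- A second order Taylor bound for `(1 + x)⁻ⁱ`. -/
lemma inv_one_add_pow_le {x : ℝ} (hx : 0 < 1 + x) (i : ℕ) :
    ((1 + x)⁻¹) ^ i ≤ 1 - i * x + i * (i + 1) / 2 * x ^ 2 * (max 1 (1 + x)⁻¹) ^ i := by
  set y := (1 + x)⁻¹ with hy
  set M := max 1 y
  have hy0 : 0 < y := inv_pos.2 hx
  have hyM : y ≤ M := le_max_right _ _
  have hM : 1 ≤ M := le_max_left _ _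
  have hxy : x * y = 1 - y := by
    rw [hy]
    field_simp
    ring
  induction i with
  | zero => simp
  | succ i ih =>
    have h1 : y ^ (i + 1) ≤ (1 - i * x + i * (i + 1) / 2 * x ^ 2 * M ^ i) * y := by
      rw [pow_succ]
      gcongr
    have h2 : (1 - i * x + i * (i + 1) / 2 * x ^ 2 * M ^ i) * y =
        1 - (i + 1) * x + x ^ 2 * (y * (i + 1 + i * (i + 1) / 2 * M ^ i)) := by
      linear_combination (1 - (i + 1) * x) * hxy
    have h3 : y * (i + 1 + i * (i + 1) / 2 * M ^ i) ≤
        M * ((i + 1) * M ^ i + i * (i + 1) / 2 * M ^ i) := by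
      gcongr
      exact le_mul_of_one_le_right (by positivity) (one_le_pow₀ hM)
    have h4 := mul_le_mul_of_nonneg_left h3 (sq_nonneg x)
    push_cast
    rw [pow_succ M]
    nlinarith

/-- The elementary estimate behind `lintegral_mix_inv_pow_le`: the left-hand side is a combination
of moments of a log-normal variable, with the cancellation in `E (R - 1)² = e^{2θ} - 1`. -/
lemma inv_moment_estimate {θ q : ℝ} (hθ : 0 ≤ θ) (hq0 : 0 ≤ q) (hq1 : q ≤ 1) (i : ℕ)
    (hi : 8 * θ * (i + 1) ≤ 1) :
    1 + i * (i + 1) / 2 * q ^ 2 * ((Real.exp (2 * θ) - 1) + (Real.exp (θ * ((2 - q * i) * (1 - q * i)))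
      - 2 * Real.exp (θ * ((1 - q * i) * (-(q * i)))) + Real.exp (θ * (q * i * (q * i + 1))))) ≤
      Real.exp (14 * q ^ 2 * θ * i ^ 2) := by
  have hi0 : (0 : ℝ) ≤ i := i.cast_nonneg
  set b := q * i with hb
  have hb0 : 0 ≤ b := by positivity
  have hbi : b ≤ i := by nlinarith
  have hθb : θ * b ≤ 1 / 8 := by nlinarith
  have hθ1 : θ ≤ 1 / 8 := by nlinarith [mul_nonneg hθ hi0]
  have hexp2 : ∀ z : ℝ, 0 ≤ z → z ≤ 1 → Real.exp z ≤ 1 + 2 * z := fun z h0 h1 => by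
    have := Real.abs_exp_sub_one_le (x := z) (by rwa [abs_of_nonneg h0])
    rw [abs_of_nonneg h0] at this
    linarith [le_abs_self (Real.exp z - 1)]
  set u := Real.exp (-2 * b * θ) with hu
  have hu0 : 0 < u := Real.exp_pos _
  have hu1 : u ≤ 1 := Real.exp_le_one_iff.2 (by nlinarith)
  have hu2 : 1 - u ≤ 2 * b * θ := by linarith [Real.add_one_le_exp (-2 * b * θ)]
  set v := Real.exp (θ * (b * (b + 1))) with hv
  set t := Real.exp (2 * θ) with ht
  have ht1 : 1 ≤ t := Real.one_le_exp (by linarith)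
  have ht2 : t - 1 ≤ 4 * θ := by linarith [hexp2 (2 * θ) (by linarith) (by linarith)]
  have e1 : Real.exp (θ * ((2 - b) * (1 - b))) = v * (u ^ 2 * t) := by
    rw [hv, hu, ht, ← Real.exp_nat_mul, ← Real.exp_add, ← Real.exp_add]
    congr 1
    push_cast
    ring
  have e2 : Real.exp (θ * ((1 - b) * (-b))) = v * u := by
    rw [hv, hu, ← Real.exp_add]
    congr 1
    ring
  rw [e1, e2]
  set w := b ^ 2 * θ with hw
  have hw0 : 0 ≤ w := by positivity
  have hv2 : v ≤ 2 * Real.exp w := by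
    have h1 : v = Real.exp (θ * b) * Real.exp w := by
      rw [hv, ← Real.exp_add]
      congr 1
      rw [hw]
      ring
    rw [h1]
    gcongr
    linarith [hexp2 (θ * b) (by positivity) (by linarith)]
  have hbr : (1 - u) ^ 2 + u ^ 2 * (t - 1) ≤ 4 * θ * Real.exp w := by
    have h1 : (1 - u) ^ 2 ≤ (2 * b * θ) ^ 2 := by gcongr
    have h2 : u ^ 2 * (t - 1) ≤ 1 * (4 * θ) := by
      gcongr
      exact pow_le_one₀ hu0.le hu1
    have h3 : (2 * b * θ) ^ 2 = 4 * θ * w := by rw [hw]; ring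
    have h4 := mul_le_mul_of_nonneg_left (Real.add_one_le_exp w) (show 0 ≤ 4 * θ by linarith)
    linarith
  have hE1 : 1 ≤ Real.exp w := Real.one_le_exp hw0
  have hprod : v * ((1 - u) ^ 2 + u ^ 2 * (t - 1)) ≤ 8 * θ * Real.exp (2 * w) := by
    calc v * ((1 - u) ^ 2 + u ^ 2 * (t - 1))
        ≤ (2 * Real.exp w) * (4 * θ * Real.exp w) := by
          gcongr
      _ = _ := by
          rw [two_mul w, Real.exp_add]
          ring
  have hi2 : (i : ℝ) * (i + 1) / 2 ≤ i ^ 2 := by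
    rcases Nat.eq_zero_or_pos i with h | h
    · simp [h]
    · have : (1 : ℝ) ≤ i := by exact_mod_cast h
      nlinarith
  have hE2 : 1 ≤ Real.exp (2 * w) := Real.one_le_exp (by linarith)
  calc 1 + i * (i + 1) / 2 * q ^ 2 * ((t - 1) + (v * (u ^ 2 * t) - 2 * (v * u) + v))
      = 1 + i * (i + 1) / 2 * q ^ 2 * ((t - 1) + v * ((1 - u) ^ 2 + u ^ 2 * (t - 1))) := by ring
    _ ≤ 1 + i ^ 2 * q ^ 2 * (4 * θ * Real.exp (2 * w) + 8 * θ * Real.exp (2 * w)) := by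
        have : 4 * θ ≤ 4 * θ * Real.exp (2 * w) := le_mul_of_one_le_right (by linarith) hE2
        have h0 : 0 ≤ v * ((1 - u) ^ 2 + u ^ 2 * (t - 1)) := by
          have : 0 ≤ t - 1 := by linarith
          positivity
        gcongr
        linarith
    _ = 1 + 12 * w * Real.exp (2 * w) := by rw [hw, hb]; ring
    _ ≤ (12 * w + 1) * Real.exp (2 * w) := by linarith
    _ ≤ Real.exp (12 * w) * Real.exp (2 * w) := by
        gcongr
        exact Real.add_one_le_exp _
    _ = _ := by
        rw [← Real.exp_add]
        congr 1
        rw [hw, hb]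
        ring

/-- The negative moments of the ratio `1 - q + q R` of the subsampled mechanism. By the weighted
AM-GM inequality `(1 - q + q R)⁻¹ ≤ R^{-q}`, which controls the remainder of a second order Taylor
expansion; the first order term has mean zero since `E R = 1`. -/
lemma lintegral_mix_inv_pow_le (hX : Measurable X)
    (hmom : ∀ a : ℝ, ∫⁻ x, ENNReal.ofReal (Real.exp (a * X x)) ∂Q =
      ENNReal.ofReal (Real.exp (θ * (a * (a - 1)))))
    (hθ : 0 ≤ θ) (hq0 : 0 ≤ q) (hq1 : q < 1) (i : ℕ) (hi : 8 * θ * (i + 1) ≤ 1) :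
    ∫⁻ x, ENNReal.ofReal (((1 - q + q * Real.exp (X x))⁻¹) ^ i) ∂Q ≤
      ENNReal.ofReal (Real.exp (14 * q ^ 2 * θ * i ^ 2)) := by
  have hJ : ∀ a c : ℝ, Integrable (fun x => c * Real.exp (a * X x)) Q ∧
      ∫ x, c * Real.exp (a * X x) ∂Q = c * Real.exp (θ * (a * (a - 1))) := by
    intro a c
    have hI : Integrable (fun x => Real.exp (a * X x)) Q := by
      refine ⟨by fun_prop, ?_⟩
      rw [hasFiniteIntegral_iff_ofReal (ae_of_all _ fun _ => (Real.exp_pos _).le), hmom]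
      exact ENNReal.ofReal_lt_top
    refine ⟨hI.const_mul c, ?_⟩
    rw [integral_const_mul, integral_eq_lintegral_of_nonneg_ae
      (ae_of_all _ fun _ => (Real.exp_pos _).le) hI.1, hmom,
      ENNReal.toReal_ofReal (Real.exp_pos _).le]
  have hadd : ∀ {f g : Ω → ℝ} {u v : ℝ}, (Integrable f Q ∧ ∫ x, f x ∂Q = u) →
      (Integrable g Q ∧ ∫ x, g x ∂Q = v) →
      (Integrable (fun x => f x + g x) Q ∧ ∫ x, f x + g x ∂Q = u + v) := by
    rintro f g u v ⟨hf, rfl⟩ ⟨hg, rfl⟩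
    exact ⟨hf.add hg, integral_add hf hg⟩
  set b := q * i with hb
  set c₀ : ℝ := i * (i + 1) / 2 * q ^ 2 with hc₀
  obtain ⟨hgI, hg⟩ := hadd (hadd (hadd (hadd (hadd (hJ 0 (1 + b + c₀)) (hJ 1 (-(b + 2 * c₀))))
    (hJ 2 c₀)) (hJ (2 - b) c₀)) (hJ (1 - b) (-2 * c₀))) (hJ (-b) c₀)
  have hpos : ∀ x, 0 < 1 + q * (Real.exp (X x) - 1) := fun x => by
    have := Real.exp_pos (X x)
    nlinarith [mul_nonneg hq0 this.le]
  have hform : ∀ x, 1 - q + q * Real.exp (X x) = 1 + q * (Real.exp (X x) - 1) := fun x => by ring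
  simp_rw [hform]
  have hpt : ∀ x, ((1 + q * (Real.exp (X x) - 1))⁻¹) ^ i ≤
      (1 + b + c₀) * Real.exp (0 * X x) + -(b + 2 * c₀) * Real.exp (1 * X x) +
        c₀ * Real.exp (2 * X x) + c₀ * Real.exp ((2 - b) * X x) +
        -2 * c₀ * Real.exp ((1 - b) * X x) + c₀ * Real.exp (-b * X x) := by
    intro x
    have h1 := inv_one_add_pow_le (hpos x) i
    have hamgm : Real.exp (q * X x) ≤ 1 + q * (Real.exp (X x) - 1) := by
      have := convexOn_exp.2 (Set.mem_univ 0) (Set.mem_univ (X x)) (by linarith : 0 ≤ 1 - q) hq0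
        (by ring)
      simp only [smul_eq_mul, mul_zero, zero_add, Real.exp_zero] at this
      linarith
    have hM : (max 1 (1 + q * (Real.exp (X x) - 1))⁻¹) ^ i ≤ 1 + Real.exp (-b * X x) := by
      rcases le_total (1 + q * (Real.exp (X x) - 1))⁻¹ 1 with h | h
      · rw [max_eq_left h, one_pow]
        linarith [Real.exp_pos (-b * X x)]
      · rw [max_eq_right h]
        have h2 : (1 + q * (Real.exp (X x) - 1))⁻¹ ≤ Real.exp (-(q * X x)) := by
          rw [Real.exp_neg]
          exact inv_anti₀ (Real.exp_pos _) hamgm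
        have h3 := pow_le_pow_left₀ (inv_nonneg.2 (hpos x).le) h2 i
        rw [← Real.exp_nat_mul] at h3
        have h4 : (i : ℝ) * -(q * X x) = -b * X x := by rw [hb]; ring
        rw [h4] at h3
        linarith
    have h5 : (0 : ℝ) ≤ i * (i + 1) / 2 * (q * (Real.exp (X x) - 1)) ^ 2 := by positivity
    refine (h1.trans (add_le_add_right (mul_le_mul_of_nonneg_left hM h5) _)).trans_eq ?_
    have e0 : Real.exp (0 * X x) = 1 := by simp
    have e1 : Real.exp (1 * X x) = Real.exp (X x) := by simp
    have e2 : Real.exp (2 * X x) = Real.exp (X x) ^ 2 := by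
      rw [← Real.exp_nat_mul]; norm_num
    have e3 : Real.exp ((2 - b) * X x) = Real.exp (X x) ^ 2 * Real.exp (-b * X x) := by
      rw [← e2, ← Real.exp_add]; congr 1; ring
    have e4 : Real.exp ((1 - b) * X x) = Real.exp (X x) * Real.exp (-b * X x) := by
      rw [← Real.exp_add]; congr 1; ring
    rw [e0, e1, e2, e3, e4, hc₀, hb]
    ring
  calc ∫⁻ x, ENNReal.ofReal (((1 + q * (Real.exp (X x) - 1))⁻¹) ^ i) ∂Q
      ≤ ∫⁻ x, ENNReal.ofReal _ ∂Q := lintegral_mono fun x => ENNReal.ofReal_le_ofReal (hpt x)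
    _ = ENNReal.ofReal _ := by
        rw [← ofReal_integral_eq_lintegral_ofReal hgI (ae_of_all _ fun x =>
          (pow_nonneg (inv_nonneg.2 (hpos x).le) i).trans (hpt x)), hg]
    _ ≤ _ := by
        apply ENNReal.ofReal_le_ofReal
        refine le_trans (le_of_eq ?_) (inv_moment_estimate hθ hq0 hq1.le i hi)
        rw [← hb, ← hc₀]
        have e0 : Real.exp (θ * (0 * (0 - 1))) = 1 := by simp
        have e1 : Real.exp (θ * (1 * (1 - 1))) = 1 := by simp
        have e2 : θ * (2 * (2 - 1)) = 2 * θ := by ring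
        have e3 : θ * ((2 - b) * (2 - b - 1)) = θ * ((2 - b) * (1 - b)) := by ring
        have e4 : θ * ((1 - b) * (1 - b - 1)) = θ * ((1 - b) * -b) := by ring
        have e5 : θ * (-b * (-b - 1)) = θ * (b * (b + 1)) := by ring
        rw [e0, e1, e2, e3, e4, e5]
        ring

end Moments

namespace IsLogNormalShift

variable {Ω : Type*} [MeasurableSpace Ω] {θ q p : ℝ} {Q Q₁ : Measure Ω}

lemma holderDom (h : IsLogNormalShift θ Q Q₁) {n : ℕ} (hpn : p.HolderConjugate n) :
    HolderDom p (ENNReal.ofReal (Real.exp (θ * (n - 1)))) Q₁ Q := by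
  obtain ⟨X, hX, rfl, hmom⟩ := h
  refine HolderDom.withDensity hpn (by fun_prop) ?_
  simp_rw [ENNReal.ofReal_rpow_of_pos (Real.exp_pos _), ← Real.exp_mul]
  refine le_of_eq ?_
  simp_rw [mul_comm (X _)]
  rw [hmom]
  congr 2
  ring

lemma holderDom_mix_left (h : IsLogNormalShift θ Q Q₁) {n : ℕ} (hpn : p.HolderConjugate n)
    (hθ : 0 ≤ θ) (hq0 : 0 ≤ q) (hq1 : q ≤ 1) (hn : 4 * θ * n ≤ 1) :
    HolderDom p (ENNReal.ofReal (Real.exp (14 * q ^ 2 * θ * n))) (mix q Q Q₁) Q := by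
  obtain ⟨X, hX, rfl, hmom⟩ := h
  rw [mix_withDensity hq0 hq1 Q hX]
  refine HolderDom.withDensity hpn (by fun_prop) ?_
  have hm := lintegral_mix_pow_mul_le hX hmom hθ hq0 hq1 n 0 (by simpa using hn)
  have hpos : ∀ x, 0 ≤ 1 - q + q * Real.exp (X x) := fun x => by
    have := Real.exp_pos (X x)
    nlinarith
  simp only [Nat.cast_zero, zero_mul, Real.exp_zero, mul_one, mul_zero, zero_add] at hm
  simp_rw [ENNReal.rpow_natCast, ← ENNReal.ofReal_pow (hpos _)]
  rw [← ENNReal.ofReal_pow (Real.exp_pos _).le, ← Real.exp_nat_mul]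
  refine hm.trans (ENNReal.ofReal_le_ofReal (Real.exp_le_exp.2 ?_))
  nlinarith [mul_nonneg (mul_nonneg (sq_nonneg q) hθ) (sq_nonneg (n : ℝ))]

lemma holderDom_mix_right (h : IsLogNormalShift θ Q Q₁) {n : ℕ} (hpn : p.HolderConjugate n)
    (hθ : 0 ≤ θ) (hq0 : 0 ≤ q) (hq1 : q < 1) (hn : 8 * θ * n ≤ 1) :
    HolderDom p (ENNReal.ofReal (Real.exp (14 * q ^ 2 * θ * n))) Q (mix q Q Q₁) := by
  obtain ⟨X, hX, rfl, hmom⟩ := h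
  rw [mix_withDensity hq0 hq1.le Q hX]
  set r : Ω → ℝ := fun x => 1 - q + q * Real.exp (X x) with hr
  have hpos : ∀ x, 0 < r x := fun x => by
    have := mul_nonneg hq0 (Real.exp_pos (X x)).le
    rw [hr]
    simp only
    linarith
  have hrm : Measurable r := by fun_prop
  have hinv : Measurable fun x => ENNReal.ofReal (r x)⁻¹ := hrm.inv.ennreal_ofReal
  -- Seen from the mixture, `Q` has density `1 / r`, whose `n`-th moment is the moment of order
  -- `-(n - 1)` of `r` under `Q`.
  have hQ : Q = (Q.withDensity fun x => ENNReal.ofReal (r x)).withDensity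
      fun x => ENNReal.ofReal (r x)⁻¹ := by
    rw [← withDensity_mul _ hrm.ennreal_ofReal hinv]
    have : ((fun x => ENNReal.ofReal (r x)) * fun x => ENNReal.ofReal (r x)⁻¹) = 1 := by
      funext x
      simp only [Pi.mul_apply, Pi.one_apply]
      rw [← ENNReal.ofReal_mul (hpos x).le, mul_inv_cancel₀ (hpos x).ne', ENNReal.ofReal_one]
    rw [this, withDensity_one]
  suffices HolderDom p (ENNReal.ofReal (Real.exp (14 * q ^ 2 * θ * n)))
      ((Q.withDensity fun x => ENNReal.ofReal (r x)).withDensity fun x => ENNReal.ofReal (r x)⁻¹)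
      (Q.withDensity fun x => ENNReal.ofReal (r x)) by rwa [← hQ] at this
  refine HolderDom.withDensity hpn hinv ?_
  obtain ⟨i, rfl⟩ : ∃ i, n = i + 1 := Nat.exists_eq_succ_of_ne_zero (by
    rintro rfl
    exact hpn.symm.ne_zero Nat.cast_zero)
  rw [lintegral_withDensity_eq_lintegral_mul _ hrm.ennreal_ofReal (hinv.pow_const _)]
  have hstep : ∀ x, ((fun x => ENNReal.ofReal (r x)) *
      fun x => ENNReal.ofReal (r x)⁻¹ ^ (((i + 1 : ℕ) : ℝ))) x = ENNReal.ofReal ((r x)⁻¹ ^ i) := by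
    intro x
    simp only [Pi.mul_apply]
    rw [ENNReal.rpow_natCast, ← ENNReal.ofReal_pow (inv_nonneg.2 (hpos x).le),
      ← ENNReal.ofReal_mul (hpos x).le]
    congr 1
    have := (hpos x).ne'
    rw [pow_succ]
    field_simp
  simp_rw [hstep]
  refine (lintegral_mix_inv_pow_le hX hmom hθ hq0 hq1 i (by push_cast at hn; exact hn)).trans ?_
  rw [ENNReal.rpow_natCast, ← ENNReal.ofReal_pow (Real.exp_pos _).le, ← Real.exp_nat_mul]
  refine ENNReal.ofReal_le_ofReal (Real.exp_le_exp.2 ?_)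
  push_cast
  have hi0 : (0 : ℝ) ≤ i := i.cast_nonneg
  have : 0 ≤ q ^ 2 * θ := by positivity
  nlinarith [mul_nonneg this hi0]

end IsLogNormalShift

/-! ### Shifts of Gaussian matrices -/

/-- Fubini's theorem for a product of functions of the single coordinates. -/
lemma lintegral_pi_prod {ι : Type*} [Fintype ι] {Ω : ι → Type*} [∀ i, MeasurableSpace (Ω i)]
    (Q : ∀ i, Measure (Ω i)) [∀ i, IsProbabilityMeasure (Q i)] (f : ∀ i, Ω i → ℝ≥0∞)
    (hf : ∀ i, Measurable (f i)) :
    ∫⁻ x, ∏ i, f i (x i) ∂Measure.pi Q = ∏ i, ∫⁻ x, f i x ∂Q i := by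
  have hind := iIndepFun_pi (μ := Q) (X := f) (fun i => (hf i).aemeasurable)
  have := lintegral_prod_eq_prod_lintegral_of_indepFun Finset.univ
    (fun i (x : ∀ i, Ω i) => f i (x i)) hind (fun i => (hf i).comp (measurable_pi_apply i))
  rw [this]
  refine Finset.prod_congr rfl fun i _ => ?_
  rw [← (measurePreserving_eval Q i).lintegral_comp (hf i)]

namespace IsLogNormalShift

lemma prod {Ω Ω' : Type*} [MeasurableSpace Ω] [MeasurableSpace Ω'] {θ θ' : ℝ}
    {Q Q₁ : Measure Ω} {P P₁ : Measure Ω'} [SFinite Q] [SFinite P] [SFinite P₁] [SFinite Q₁]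
    (h : IsLogNormalShift θ Q Q₁) (h' : IsLogNormalShift θ' P P₁) :
    IsLogNormalShift (θ + θ') (Q.prod P) (Q₁.prod P₁) := by
  obtain ⟨X, hX, rfl, hmom⟩ := h
  obtain ⟨Y, hY, rfl, hmom'⟩ := h'
  refine ⟨fun x => X x.1 + Y x.2, by fun_prop, ?_, fun a => ?_⟩
  · rw [prod_withDensity (by fun_prop) (by fun_prop)]
    congr 1
    funext x
    rw [Real.exp_add, ENNReal.ofReal_mul (Real.exp_pos _).le]
  · simp_rw [mul_add, Real.exp_add, ENNReal.ofReal_mul (Real.exp_pos _).le]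
    rw [lintegral_prod_mul (f := fun x => ENNReal.ofReal (Real.exp (a * X x)))
      (g := fun y => ENNReal.ofReal (Real.exp (a * Y y))) (by fun_prop) (by fun_prop), hmom, hmom', ← ENNReal.ofReal_mul
      (Real.exp_pos _).le, ← Real.exp_add, add_mul]

lemma pi {ι : Type*} [Fintype ι] {Ω : ι → Type*} [∀ i, MeasurableSpace (Ω i)] {θ : ι → ℝ}
    {Q Q₁ : ∀ i, Measure (Ω i)} [∀ i, IsProbabilityMeasure (Q i)]
    [∀ i, IsProbabilityMeasure (Q₁ i)] (h : ∀ i, IsLogNormalShift (θ i) (Q i) (Q₁ i)) :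
    IsLogNormalShift (∑ i, θ i) (Measure.pi Q) (Measure.pi Q₁) := by
  choose X hX hQ hmom using h
  refine ⟨fun x => ∑ i, X i (x i), by fun_prop, ?_, fun a => ?_⟩
  · refine Measure.pi_eq (μ := Q₁) fun s hs => ?_
    rw [withDensity_apply _ (MeasurableSet.univ_pi hs),
      ← lintegral_indicator (MeasurableSet.univ_pi hs)]
    have : ∀ x : ∀ i, Ω i, (Set.univ.pi s).indicator
        (fun x => ENNReal.ofReal (Real.exp (∑ i, X i (x i)))) x =
        ∏ i, (s i).indicator (fun y => ENNReal.ofReal (Real.exp (X i y))) (x i) := by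
      intro x
      by_cases hx : x ∈ Set.univ.pi s
      · rw [Set.indicator_of_mem hx, Real.exp_sum,
          ENNReal.ofReal_prod_of_nonneg fun _ _ => (Real.exp_pos _).le]
        exact Finset.prod_congr rfl fun i _ => by
          rw [Set.indicator_of_mem (hx i trivial)]
      · rw [Set.indicator_of_notMem hx]
        simp only [Set.mem_univ_pi, not_forall] at hx
        obtain ⟨i, hi⟩ := hx
        exact (Finset.prod_eq_zero (Finset.mem_univ i) (Set.indicator_of_notMem hi _)).symm
    simp_rw [this]
    rw [lintegral_pi_prod Q (fun i => (s i).indicator fun y => ENNReal.ofReal (Real.exp (X i y)))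
      fun i => Measurable.indicator (by have := hX i; fun_prop) (hs i)]
    refine Finset.prod_congr rfl fun i _ => ?_
    rw [lintegral_indicator (hs i), hQ i, withDensity_apply _ (hs i)]
  · simp_rw [Finset.mul_sum, Real.exp_sum,
      ENNReal.ofReal_prod_of_nonneg fun _ _ => (Real.exp_pos _).le]
    rw [lintegral_pi_prod Q (fun i y => ENNReal.ofReal (Real.exp (a * X i y)))
      fun i => by have := hX i; fun_prop]
    simp_rw [hmom]
    rw [← ENNReal.ofReal_prod_of_nonneg fun _ _ => (Real.exp_pos _).le, ← Real.exp_sum,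
      Finset.sum_mul]

lemma map_equiv {Ω Ω' : Type*} [MeasurableSpace Ω] [MeasurableSpace Ω'] {θ : ℝ}
    {Q Q₁ : Measure Ω} (h : IsLogNormalShift θ Q Q₁) (e : Ω ≃ᵐ Ω') :
    IsLogNormalShift θ (Q.map e) (Q₁.map e) := by
  obtain ⟨X, hX, rfl, hmom⟩ := h
  refine ⟨fun y => X (e.symm y), hX.comp e.symm.measurable, ?_, fun a => ?_⟩
  · ext s hs
    rw [e.map_apply, withDensity_apply _ hs, withDensity_apply _ (e.measurable hs),
      setLIntegral_map hs (by fun_prop) e.measurable]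
    simp
  · rw [lintegral_map (by fun_prop) e.measurable]
    simpa using hmom a

lemma gaussianReal (μ₀ μ₁ : ℝ) {s : ℝ} (hs : 0 < s) :
    IsLogNormalShift ((μ₁ - μ₀) ^ 2 / (2 * s ^ 2)) (gaussianReal μ₀ (s ^ 2).toNNReal)
      (ProbabilityTheory.gaussianReal μ₁ (s ^ 2).toNNReal) := by
  have hv : (s ^ 2).toNNReal ≠ 0 := by
    simp only [ne_eq, Real.toNNReal_eq_zero, not_le]
    positivity
  have hcoe : ((s ^ 2).toNNReal : ℝ) = s ^ 2 := Real.coe_toNNReal _ (by positivity)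
  refine ⟨fun x => (μ₁ - μ₀) / s ^ 2 * x + (μ₀ ^ 2 - μ₁ ^ 2) / (2 * s ^ 2), by fun_prop, ?_,
    fun a => ?_⟩
  · rw [gaussianReal_of_var_ne_zero _ hv, gaussianReal_of_var_ne_zero _ hv,
      ← withDensity_mul _ (measurable_gaussianPDF _ _) (by fun_prop)]
    congr 1
    funext x
    simp only [Pi.mul_apply, gaussianPDF]
    rw [← ENNReal.ofReal_mul (gaussianPDFReal_nonneg _ _ _)]
    congr 1
    simp only [gaussianPDFReal_def]
    rw [mul_assoc _ (Real.exp _) (Real.exp _), ← Real.exp_add, hcoe]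
    congr 2
    field_simp
    ring
  · have hmgf := mgf_gaussianReal (p := ProbabilityTheory.gaussianReal μ₀ (s ^ 2).toNNReal)
      (X := id) (Measure.map_id) (a * ((μ₁ - μ₀) / s ^ 2))
    have hI := integrable_exp_mul_gaussianReal (μ := μ₀) (v := (s ^ 2).toNNReal)
      (a * ((μ₁ - μ₀) / s ^ 2))
    have hform : ∀ x, Real.exp (a * ((μ₁ - μ₀) / s ^ 2 * x + (μ₀ ^ 2 - μ₁ ^ 2) / (2 * s ^ 2))) =
        Real.exp (a * ((μ₀ ^ 2 - μ₁ ^ 2) / (2 * s ^ 2))) *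
          Real.exp (a * ((μ₁ - μ₀) / s ^ 2) * x) := fun x => by
      rw [← Real.exp_add]
      congr 1
      ring
    simp_rw [hform]
    rw [← ofReal_integral_eq_lintegral_ofReal (hI.const_mul _)
      (ae_of_all _ fun _ => by positivity), integral_const_mul]
    simp only [mgf, id] at hmgf
    rw [hmgf, ← Real.exp_add, hcoe]
    congr 2
    field_simp
    ring

end IsLogNormalShift

/-- The entries of a matrix, as a measurable equivalence. -/
def matEquiv (m n : ℕ) : (Fin m → Fin n → ℝ) ≃ᵐ Mat m n where
  toEquiv := Matrix.of
  measurable_toFun := measurable_id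
  measurable_invFun := measurable_id

lemma gaussianMatrix_map_add {m n : ℕ} (M : Mat m n) (s : ℝ) :
    (gaussianMatrix m n s).map (fun G => M + G) =
      (Measure.pi fun i => Measure.pi fun j => gaussianReal (M i j) (s ^ 2).toNNReal).map
        (matEquiv m n) := by
  have h1 : ∀ i j, gaussianReal (M i j) (s ^ 2).toNNReal =
      (gaussianReal 0 (s ^ 2).toNNReal).map (fun x => M i j + x) := fun i j => by
    rw [gaussianReal_map_const_add, zero_add]
  have h2 : ∀ i, (Measure.pi fun j => gaussianReal (M i j) (s ^ 2).toNNReal) =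
      (Measure.pi fun _ : Fin n => gaussianReal 0 (s ^ 2).toNNReal).map
        (fun x j => M i j + x j) := fun i => by
    simp_rw [h1]
    exact (Measure.pi_map_pi fun j => by fun_prop).symm
  simp_rw [h2]
  rw [← Measure.pi_map_pi (μ := fun _ : Fin m => Measure.pi fun _ : Fin n =>
    gaussianReal 0 (s ^ 2).toNNReal) (f := fun i x j => M i j + x j) (fun i =>
      (measurable_pi_lambda _ fun j => (measurable_pi_apply j).const_add _).aemeasurable),
    gaussianMatrix]
  have h3 : Measurable (Matrix.of : (Fin m → Fin n → ℝ) → Mat m n) := measurable_id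
  have h4 : Measurable fun (x : Fin m → Fin n → ℝ) i j => M i j + x i j := by fun_prop
  rw [Measure.map_map (by exact h4) h3, Measure.map_map (matEquiv m n).measurable h4]
  rfl

instance (m n : ℕ) (s : ℝ) : IsProbabilityMeasure (gaussianMatrix m n s) :=
  Measure.isProbabilityMeasure_map (f := Matrix.of) (by exact measurable_id.aemeasurable)

lemma isLogNormalShift_gaussianMatrix {m n : ℕ} (M₀ M₁ : Mat m n) {s : ℝ} (hs : 0 < s) :
    IsLogNormalShift (∑ i, ∑ j, (M₁ i j - M₀ i j) ^ 2 / (2 * s ^ 2))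
      ((gaussianMatrix m n s).map fun G => M₀ + G) ((gaussianMatrix m n s).map fun G => M₁ + G) := by
  rw [gaussianMatrix_map_add, gaussianMatrix_map_add]
  have h : ∀ i, IsLogNormalShift (∑ j, (M₁ i j - M₀ i j) ^ 2 / (2 * s ^ 2))
      (Measure.pi fun j => gaussianReal (M₀ i j) (s ^ 2).toNNReal)
      (Measure.pi fun j => gaussianReal (M₁ i j) (s ^ 2).toNNReal) := fun i =>
    IsLogNormalShift.pi fun j => IsLogNormalShift.gaussianReal (M₀ i j) (M₁ i j) hs
  have i1 : ∀ (M : Mat m n) (i : Fin m), IsProbabilityMeasure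
      (Measure.pi fun j => gaussianReal (M i j) (s ^ 2).toNNReal) := fun M i => inferInstance
  exact (IsLogNormalShift.pi h).map_equiv _

/-! ### Measurability of the algorithm -/

section Measurability

variable {α : Type*} [MeasurableSpace α] {m n r k : ℕ}

lemma measurable_mat {f : α → Mat m n} (h : ∀ i j, Measurable fun x => f x i j) : Measurable f :=
  measurable_pi_iff.2 fun i => measurable_pi_iff.2 (h i)

lemma measurable_entry {f : α → Mat m n} (h : Measurable f) (i : Fin m) (j : Fin n) :
    Measurable fun x => f x i j :=
  measurable_pi_iff.1 (measurable_pi_iff.1 h i) j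

lemma measurable_mat_mul {f : α → Mat m n} {g : α → Mat n k} (hf : Measurable f)
    (hg : Measurable g) : Measurable fun x => f x * g x :=
  measurable_mat fun i j => by
    simp only [Matrix.mul_apply]
    exact Finset.measurable_sum _ fun l _ => (measurable_entry hf i l).mul (measurable_entry hg l j)

lemma measurable_mat_transpose {f : α → Mat m n} (hf : Measurable f) :
    Measurable fun x => (f x).transpose :=
  measurable_mat fun i j => measurable_entry hf j i

lemma measurable_mat_add {f g : α → Mat m n} (hf : Measurable f) (hg : Measurable g) :
    Measurable fun x => f x + g x :=
  measurable_mat fun i j => (measurable_entry hf i j).add (measurable_entry hg i j)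

lemma measurable_mat_smul {c : α → ℝ} {f : α → Mat m n} (hc : Measurable c) (hf : Measurable f) :
    Measurable fun x => c x • f x :=
  measurable_mat fun i j => hc.mul (measurable_entry hf i j)

lemma measurable_mat_sum {ι : Type*} (s : Finset ι) {f : ι → α → Mat m n}
    (hf : ∀ l, Measurable (f l)) : Measurable fun x => ∑ l ∈ s, f l x :=
  measurable_mat fun i j => by
    simp only [Matrix.sum_apply]
    exact Finset.measurable_sum _ fun l _ => measurable_entry (hf l) i j

lemma measurable_clip {C : ℝ} {f : α → Mat m n} (hf : Measurable f) :
    Measurable fun x => clip C (f x) := by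
  refine measurable_mat_smul ?_ hf
  have : Measurable fun x => frobNorm (f x) := by
    unfold frobNorm
    exact (Finset.measurable_sum _ fun i _ => Finset.measurable_sum _ fun j _ =>
      (measurable_entry hf i j).pow_const 2).sqrt
  fun_prop

lemma measurable_orthRows {f : α → Mat m n} (hf : Measurable f) :
    Measurable fun x => orthRows (f x) := by
  have hrow : ∀ i, Measurable fun x => (WithLp.toLp 2 (f x i) : EuclideanSpace ℝ (Fin n)) :=
    fun i => (WithLp.measurable_toLp 2 _).comp (measurable_pi_iff.1 hf i)
  have hgs : ∀ i, Measurable fun x => InnerProductSpace.gramSchmidt ℝ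
      (fun i : Fin m => (WithLp.toLp 2 (f x i) : EuclideanSpace ℝ (Fin n))) i := by
    intro i
    induction i using WellFoundedLT.induction with
    | ind i ih =>
      simp_rw [InnerProductSpace.gramSchmidt_def ℝ _ i, Submodule.starProjection_singleton]
      refine (hrow i).sub (Finset.measurable_sum _ fun l hl => ?_)
      have h := ih l (Finset.mem_Iio.1 hl)
      exact ((h.inner (hrow i)).div (h.norm.pow_const 2)).smul h
  refine measurable_mat fun i j => ?_
  have h1 : Measurable fun x => InnerProductSpace.gramSchmidtNormed ℝ
      (fun i : Fin m => (WithLp.toLp 2 (f x i) : EuclideanSpace ℝ (Fin n))) i := by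
    unfold InnerProductSpace.gramSchmidtNormed
    exact (hgs i).norm.inv.smul (hgs i)
  exact (measurable_pi_apply j).comp ((WithLp.measurable_ofLp 2 _).comp h1)

lemma measurable_powerLoop {W : α → Mat m n} {Q₀ : α → Mat r n} (hW : Measurable W)
    (hQ : Measurable Q₀) (k : ℕ) : Measurable fun x => powerLoop (W x) k (Q₀ x) := by
  induction k with
  | zero => exact measurable_const.prodMk hQ
  | succ k ih =>
    simp only [powerLoop, Function.iterate_succ_apply'] at ih ⊢
    have hA := measurable_mat_mul (measurable_mat_transpose (measurable_mat_transpose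
      (measurable_orthRows (measurable_mat_transpose
        (measurable_mat_mul hW (measurable_mat_transpose ih.snd)))))) hW
    exact hA.prodMk (measurable_orthRows hA)

lemma measurable_powerDP {W : α → Mat m n} {Q₀ : α → Mat r n} {GB : α → Mat m r}
    {GA : α → Mat r n} (hW : Measurable W) (hQ : Measurable Q₀) (hB : Measurable GB)
    (hA : Measurable GA) (k : ℕ) : Measurable fun x => powerDP (W x) k (Q₀ x) (GB x) (GA x) := by
  have h := measurable_powerLoop hW hQ k
  exact (measurable_orthRows (measurable_mat_add h.fst hA)).prodMk
    (measurable_mat_add (measurable_mat_mul hW (measurable_mat_transpose h.snd)) hB)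

variable {Z : Type*}

/-- The local gradients are measurable functions of the LoRA modules: they are line derivatives of
a continuous function on the space of pairs `(A, B)`. -/
lemma measurable_localStep (I : Input m n r Z) (hℓ : DifferentiableLoss I.ℓ) (d : List Z)
    (b : Fin d.length → Bool) : Measurable (localStep I d b) := by
  let F : (Fin r → Fin n → ℝ) × (Fin m → Fin r → ℝ) → ℝ := fun p =>
    batchLoss I.ℓ d b (Matrix.of p.1) (Matrix.of p.2)
  have hF : Continuous F := by
    unfold F batchLoss
    exact (continuous_finsetSum _ fun j _ => (hℓ (d.get j)).continuous).div_const _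
  have hA : Measurable fun s : Mat r n × Mat m r =>
      matGrad (fun A => batchLoss I.ℓ d b A s.2) s.1 := by
    refine measurable_mat fun i j => ?_
    have h := measurable_lineDeriv (𝕜 := ℝ) (v := (Matrix.of.symm (Matrix.single i j 1), 0)) hF
    have e : (fun s : Mat r n × Mat m r =>
        matGrad (fun A => batchLoss I.ℓ d b A s.2) s.1 i j) = fun s => lineDeriv ℝ F
          (Matrix.of.symm s.1, Matrix.of.symm s.2) (Matrix.of.symm (Matrix.single i j 1), 0) := by
      funext s
      refine congrArg (fun g : ℝ → ℝ => deriv g 0) (funext fun t => ?_)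
      change _ = batchLoss I.ℓ d b (s.1 + t • Matrix.single i j 1) (s.2 + t • 0)
      rw [smul_zero, add_zero]
    rw [e]
    exact h
  have hB : Measurable fun s : Mat r n × Mat m r =>
      matGrad (fun B => batchLoss I.ℓ d b s.1 B) s.2 := by
    refine measurable_mat fun i j => ?_
    have h := measurable_lineDeriv (𝕜 := ℝ) (v := (0, Matrix.of.symm (Matrix.single i j 1))) hF
    have e : (fun s : Mat r n × Mat m r =>
        matGrad (fun B => batchLoss I.ℓ d b s.1 B) s.2 i j) = fun s => lineDeriv ℝ F
          (Matrix.of.symm s.1, Matrix.of.symm s.2) (0, Matrix.of.symm (Matrix.single i j 1)) := by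
      funext s
      refine congrArg (fun g : ℝ → ℝ => deriv g 0) (funext fun t => ?_)
      change _ = batchLoss I.ℓ d b (s.1 + t • 0) (s.2 + t • Matrix.single i j 1)
      rw [smul_zero, add_zero]
    rw [e]
    exact h
  have hneg : ∀ {a c : ℕ} {f g : Mat r n × Mat m r → Mat a c}, Measurable f → Measurable g →
      Measurable fun s => f s - I.η • g s := fun hf hg =>
    measurable_mat fun i j => (measurable_entry hf i j).sub
      (measurable_entry (measurable_mat_smul measurable_const hg) i j)
  exact (hneg measurable_fst hA).prodMk (hneg measurable_snd hB)

lemma measurable_localTrain (I : Input m n r Z) (hℓ : DifferentiableLoss I.ℓ) (d : List Z)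
    (b : Fin I.L → Fin d.length → Bool) : Measurable (localTrain I d b) := by
  suffices ∀ (L : ℕ) (b : Fin L → Fin d.length → Bool), Measurable fun s =>
      Fin.foldl L (fun s l => localStep I d (b l) s) s from this I.L b
  intro L
  induction L with
  | zero =>
    intro b
    simp only [Fin.foldl_zero]
    exact measurable_id
  | succ L ih =>
    intro b
    simp_rw [Fin.foldl_succ_last]
    exact (measurable_localStep I hℓ d _).comp (ih fun l => b l.castSucc)

lemma measurable_aggregate (I : Input m n r Z) (hℓ : DifferentiableLoss I.ℓ) (D : FedDataset Z)
    (c : Fin D.N → Bool) (β : Batches I.L D) : Measurable (aggregate I D c β) := by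
  refine measurable_mat_smul measurable_const (measurable_mat_sum _ fun i => measurable_clip ?_)
  have h := measurable_localTrain I hℓ (D.data i) (β i)
  exact measurable_mat_mul h.snd h.fst

lemma measurable_globalRound (I : Input m n r Z) (hℓ : DifferentiableLoss I.ℓ)
    (D : FedDataset Z) : Measurable fun p : (Mat r n × Mat m r) × RoundRand m n r I.L D =>
      globalRound I D p.1 p.2 := by
  have h : Measurable fun p : (Mat r n × Mat m r) × ((Fin D.N → Bool) × Batches I.L D) =>
      aggregate I D p.2.1 p.2.2 p.1 :=
    measurable_from_prod_countable_left fun y => measurable_aggregate I hℓ D y.1 y.2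
  have hπ : Measurable fun p : (Mat r n × Mat m r) × RoundRand m n r I.L D =>
      (p.1, (p.2.1, p.2.2.1)) :=
    measurable_fst.prodMk (measurable_snd.fst.prodMk measurable_snd.snd.fst)
  have h' : Measurable fun p : (Mat r n × Mat m r) × RoundRand m n r I.L D =>
      aggregate I D p.2.1 p.2.2.1 p.1 := by
    have h0 := h.comp hπ
    exact h0
  unfold globalRound
  have h2 : Measurable fun p : (Mat r n × Mat m r) × RoundRand m n r I.L D => p.2.2.2 :=
    measurable_snd.comp (measurable_snd.comp measurable_snd)
  exact measurable_powerDP (α := (Mat r n × Mat m r) × RoundRand m n r I.L D)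
    (Q₀ := fun p => p.2.2.2.1) (GB := fun p => p.2.2.2.2.1) (GA := fun p => p.2.2.2.2.2)
    h' h2.fst h2.snd.fst h2.snd.snd I.k

end Measurability

/-! ### Size of the matrices released by PowerDP -/

/-- Bessel's inequality for the rows of a Gram-Schmidt orthonormalization. -/
lemma sum_sq_orthRows_le {m n : ℕ} (M : Mat m n) (x : Fin n → ℝ) :
    ∑ i, (∑ j, orthRows M i j * x j) ^ 2 ≤ ∑ j, x j ^ 2 := by
  classical
  set e := InnerProductSpace.gramSchmidtNormed ℝ
    (fun i : Fin m => (WithLp.toLp 2 (M i) : EuclideanSpace ℝ (Fin n))) with he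
  set y : EuclideanSpace ℝ (Fin n) := WithLp.toLp 2 x
  have hin : ∀ i, ∑ j, orthRows M i j * x j = inner ℝ (e i) y := fun i => by
    simp [PiLp.inner_apply, orthRows, he, y, mul_comm]
  have hnorm : ∑ j, x j ^ 2 = ‖y‖ ^ 2 := by simp [EuclideanSpace.norm_sq_eq, y]
  simp_rw [hin, hnorm]
  have hon := InnerProductSpace.gramSchmidtNormed_orthonormal' (𝕜 := ℝ)
    (fun i : Fin m => (WithLp.toLp 2 (M i) : EuclideanSpace ℝ (Fin n)))
  have hb := hon.sum_inner_products_le y (s := Finset.univ)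
  refine le_trans (le_of_eq ?_) hb
  have h0 : ∀ i, (inner ℝ (e i) y : ℝ) ^ 2 = ‖(inner ℝ (e i) y : ℝ)‖ ^ 2 := fun i => by simp
  simp_rw [h0]
  -- Only the nonzero vectors form an orthonormal family; the others do not contribute.
  rw [← Finset.sum_filter_of_ne (p := fun i => e i ≠ 0) fun i _ hi h => hi (by simp [h])]
  exact Finset.sum_subtype _ (fun i => by simp [e]) _

lemma sum_sq_mul_orthRows_transpose_le {m n r : ℕ} (W : Mat m n) (M : Mat r n) :
    ∑ i, ∑ j, (W * (orthRows M).transpose) i j ^ 2 ≤ ∑ i, ∑ j, W i j ^ 2 := by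
  refine Finset.sum_le_sum fun i _ => ?_
  simpa [Matrix.mul_apply, mul_comm] using sum_sq_orthRows_le M (W i)

lemma sum_sq_orthCols_transpose_mul_le {m n r : ℕ} (W : Mat m n) (M : Mat m r) :
    ∑ i, ∑ j, ((orthCols M).transpose * W) i j ^ 2 ≤ ∑ i, ∑ j, W i j ^ 2 := by
  rw [Finset.sum_comm, Finset.sum_comm (f := fun i j => W i j ^ 2)]
  refine Finset.sum_le_sum fun j _ => ?_
  simpa [Matrix.mul_apply, orthCols] using sum_sq_orthRows_le M.transpose fun i => W i j

/-- Before the noise is added, neither of the two matrices computed by PowerDP is larger than the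
input, whatever the initialization. -/
lemma powerLoop_sum_sq_le {m n r k : ℕ} (hk : 1 ≤ k) (W : Mat m n) (Q₀ : Mat r n) :
    ∑ i, ∑ j, (powerLoop W k Q₀).1 i j ^ 2 ≤ ∑ i, ∑ j, W i j ^ 2 ∧
      ∑ i, ∑ j, (W * (powerLoop W k Q₀).2.transpose) i j ^ 2 ≤ ∑ i, ∑ j, W i j ^ 2 := by
  obtain ⟨k, rfl⟩ := Nat.exists_eq_add_of_le' hk
  rw [powerLoop, Function.iterate_succ_apply']
  exact ⟨sum_sq_orthCols_transpose_mul_le _ _, sum_sq_mul_orthRows_transpose_le _ _⟩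

section Frobenius

attribute [local instance] Matrix.frobeniusNormedAddCommGroup Matrix.frobeniusNormedSpace

lemma frobNorm_eq_norm {m n : ℕ} (W : Mat m n) : frobNorm W = ‖W‖ := by
  rw [Matrix.frobenius_norm_def, frobNorm, Real.sqrt_eq_rpow]
  simp

lemma frobNorm_clip_le {m n : ℕ} {C : ℝ} (hC : 0 < C) (W : Mat m n) : frobNorm (clip C W) ≤ C := by
  have hM : 0 < max 1 (frobNorm W / C) := lt_max_of_lt_left one_pos
  rw [frobNorm_eq_norm, clip, norm_smul, Real.norm_of_nonneg (inv_nonneg.2 hM.le),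
    ← frobNorm_eq_norm, inv_mul_le_iff₀ hM]
  exact (div_le_iff₀ hC).1 (le_max_right _ _)

lemma frobNorm_aggregate_le {m n r : ℕ} {Z : Type*} (I : Input m n r Z) (hC : 0 < I.C)
    (D : FedDataset Z) (c : Fin D.N → Bool) (β : Batches I.L D) (s : Mat r n × Mat m r) :
    frobNorm (aggregate I D c β s) ≤ I.C := by
  rw [frobNorm_eq_norm, aggregate, norm_smul, norm_inv, Real.norm_natCast]
  set F := Finset.univ.filter fun i => c i = true
  have hsum : ‖∑ i ∈ F, clientUpdate I (D.data i) (β i) s‖ ≤ F.card * I.C := by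
    refine (norm_sum_le _ _).trans ((Finset.sum_le_card_nsmul _ _ I.C fun i _ => ?_).trans_eq
      (nsmul_eq_mul _ _))
    rw [← frobNorm_eq_norm]
    exact frobNorm_clip_le hC _
  rcases Nat.eq_zero_or_pos F.card with h | h
  · rw [h]
    simpa using hC.le
  · rw [inv_mul_le_iff₀ (by exact_mod_cast h)]
    exact hsum

end Frobenius

lemma sum_sq_sub_le {m n : ℕ} {X Y : Mat m n} {c : ℝ} (hX : ∑ i, ∑ j, X i j ^ 2 ≤ c)
    (hY : ∑ i, ∑ j, Y i j ^ 2 ≤ c) : ∑ i, ∑ j, (X i j - Y i j) ^ 2 ≤ 4 * c := by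
  calc ∑ i, ∑ j, (X i j - Y i j) ^ 2 ≤ ∑ i, ∑ j, (2 * X i j ^ 2 + 2 * Y i j ^ 2) := by
        gcongr with i _ j _
        nlinarith [sq_nonneg (X i j + Y i j)]
    _ = 2 * ∑ i, ∑ j, X i j ^ 2 + 2 * ∑ i, ∑ j, Y i j ^ 2 := by
        simp_rw [Finset.sum_add_distrib, Finset.mul_sum]
    _ ≤ 4 * c := by linarith

/-! ### The output law of PowerDP -/

/-- The law of the output of PowerDP on `W`, given the initialization `Q₀`, with noise of standard
deviation `s`. -/
def powerDPLaw {m n r : ℕ} (W : Mat m n) (k : ℕ) (s : ℝ) (Q₀ : Mat r n) :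
    Measure (Mat r n × Mat m r) :=
  ((gaussianMatrix m r s).prod (gaussianMatrix r n s)).map fun g => powerDP W k Q₀ g.1 g.2

instance {m n r : ℕ} (W : Mat m n) (k : ℕ) (s : ℝ) (Q₀ : Mat r n) :
    IsProbabilityMeasure (powerDPLaw (m := m) W k s Q₀) :=
  Measure.isProbabilityMeasure_map (measurable_powerDP measurable_const measurable_const
    measurable_fst measurable_snd k).aemeasurable

/-- The output law of PowerDP is a post-processing of a Gaussian law. Two of these Gaussian laws,
for inputs of Frobenius norm at most `C` and noise `σ C`, are shifts of each other with parameter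
`θ` at most `4 / σ²`. -/
lemma exists_shift_powerDPLaw {m n r k : ℕ} (hk : 1 ≤ k) {σ C : ℝ} (hσ : 0 < σ) (hC : 0 < C)
    {W W' : Mat m n} (hW : frobNorm W ≤ C) (hW' : frobNorm W' ≤ C) (Q₀ Q₀' : Mat r n) :
    ∃ (θ : ℝ) (Q Q' : Measure (Mat m r × Mat r n)) (f : Mat m r × Mat r n → Mat r n × Mat m r),
      Measurable f ∧ 0 ≤ θ ∧ θ ≤ 4 / σ ^ 2 ∧ IsLogNormalShift θ Q Q' ∧
      powerDPLaw W k (σ * C) Q₀ = Q.map f ∧ powerDPLaw W' k (σ * C) Q₀' = Q'.map f := by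
  have hs : 0 < σ * C := mul_pos hσ hC
  have hadd : ∀ {a b : ℕ} (M : Mat a b), Measurable fun G : Mat a b => M + G := fun M =>
    measurable_mat_add measurable_const measurable_id
  have hlaw : ∀ (V : Mat m n) (P₀ : Mat r n), powerDPLaw V k (σ * C) P₀ =
      (((gaussianMatrix m r (σ * C)).map fun G => V * (powerLoop V k P₀).2.transpose + G).prod
        ((gaussianMatrix r n (σ * C)).map fun G => (powerLoop V k P₀).1 + G)).map
          fun p => (orthRows p.2, p.1) := fun V P₀ => by
    rw [Measure.map_prod_map _ _ (hadd _) (hadd _), Measure.map_map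
      ((measurable_orthRows measurable_snd).prodMk measurable_fst) ((hadd _).prodMap (hadd _))]
    rfl
  have hsq : ∀ {V : Mat m n}, frobNorm V ≤ C → ∑ i, ∑ j, V i j ^ 2 ≤ C ^ 2 := fun {V} hV =>
    (Real.sqrt_le_left hC.le).1 hV
  have hB := isLogNormalShift_gaussianMatrix (W * (powerLoop W k Q₀).2.transpose)
    (W' * (powerLoop W' k Q₀').2.transpose) hs
  have hA := isLogNormalShift_gaussianMatrix (powerLoop W k Q₀).1 (powerLoop W' k Q₀').1 hs
  have hP : ∀ {a b : ℕ} (M : Mat a b), IsProbabilityMeasure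
      ((gaussianMatrix a b (σ * C)).map fun G => M + G) := fun M =>
    Measure.isProbabilityMeasure_map (hadd M).aemeasurable
  refine ⟨_, _, _, _, (measurable_orthRows measurable_snd).prodMk measurable_fst, ?_, ?_,
    hB.prod hA, hlaw W Q₀, hlaw W' Q₀'⟩
  · positivity
  · obtain ⟨h1, h2⟩ := powerLoop_sum_sq_le hk W Q₀
    obtain ⟨h1', h2'⟩ := powerLoop_sum_sq_le hk W' Q₀'
    have h3 := sum_sq_sub_le (h1'.trans (hsq hW')) (h1.trans (hsq hW))
    have h4 := sum_sq_sub_le (h2'.trans (hsq hW')) (h2.trans (hsq hW))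
    simp_rw [← Finset.sum_div]
    rw [← add_div, div_le_div_iff₀ (by positivity) (by positivity)]
    nlinarith [sq_nonneg σ]

/-! ### One round, on adjacent datasets -/

lemma measurable_measure_map {α β γ : Type*} [MeasurableSpace α] [MeasurableSpace β]
    [MeasurableSpace γ] (ν : Measure β) [SFinite ν] {g : α × β → γ} (hg : Measurable g) :
    Measurable fun x => ν.map fun y => g (x, y) := by
  have h := (Measure.measurable_map g hg).comp (Measurable.map_prodMk_left (ν := ν) (α := α))
  convert! h using 2 with x
  exact (Measure.map_map hg measurable_prodMk_left).symm

lemma measurable_mix {α Ω : Type*} [MeasurableSpace α] [MeasurableSpace Ω] (q : ℝ)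
    {K K' : α → Measure Ω} (hK : Measurable K) (hK' : Measurable K') :
    Measurable fun x => mix q (K x) (K' x) := by
  refine Measure.measurable_of_measurable_coe _ fun s hs => ?_
  simp only [mix, Measure.add_apply, Measure.smul_apply, smul_eq_mul]
  exact (((Measure.measurable_coe hs).comp hK).const_mul _).add
    (((Measure.measurable_coe hs).comp hK').const_mul _)

/-- Separating one coordinate in an integral over a finite product. -/
lemma lintegral_pi_succAbove {N : ℕ} {α : Fin (N + 1) → Type*} [∀ i, MeasurableSpace (α i)]
    (μ : ∀ i, Measure (α i)) [∀ i, SigmaFinite (μ i)] (i : Fin (N + 1))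
    {g : (∀ j, α j) → ℝ≥0∞} (hg : Measurable g) :
    ∫⁻ x, g x ∂Measure.pi μ =
      ∫⁻ x, ∫⁻ y, g (i.insertNth x y) ∂(Measure.pi fun j => μ (i.succAbove j)) ∂μ i := by
  have h := (measurePreserving_piFinSuccAbove μ i).symm
  have hgh : Measurable fun z => g ((MeasurableEquiv.piFinSuccAbove α i).symm z) :=
    hg.comp h.measurable
  rw [← h.lintegral_comp hg, lintegral_prod _ hgh.aemeasurable]
  rfl

lemma lintegral_prod_four {α β γ δ : Type*} [MeasurableSpace α] [MeasurableSpace β]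
    [MeasurableSpace γ] [MeasurableSpace δ] (μ₁ : Measure α) (μ₂ : Measure β) (μ₃ : Measure γ)
    (μ₄ : Measure δ) [SFinite μ₂] [SFinite μ₃] [SFinite μ₄] {f : α × β × γ × δ → ℝ≥0∞}
    (hf : Measurable f) :
    ∫⁻ x, f x ∂μ₁.prod (μ₂.prod (μ₃.prod μ₄)) =
      ∫⁻ a, ∫⁻ b, ∫⁻ c, ∫⁻ d, f (a, b, c, d) ∂μ₄ ∂μ₃ ∂μ₂ ∂μ₁ := by
  rw [lintegral_prod _ hf.aemeasurable]
  refine lintegral_congr fun a => ?_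
  have h1 : Measurable fun x => f (a, x) := by fun_prop
  rw [lintegral_prod _ h1.aemeasurable]
  refine lintegral_congr fun b => ?_
  have h2 : Measurable fun x => f (a, b, x) := by fun_prop
  rw [lintegral_prod _ h2.aemeasurable]

lemma lintegral_linear {α : Type*} [MeasurableSpace α] (μ : Measure α) (a b : ℝ≥0∞)
    {f g : α → ℝ≥0∞} (hf : Measurable f) (hg : Measurable g) :
    ∫⁻ x, a * f x + b * g x ∂μ = a * ∫⁻ x, f x ∂μ + b * ∫⁻ x, g x ∂μ := by
  rw [lintegral_add_left (hf.const_mul a), lintegral_const_mul _ hf, lintegral_const_mul _ hg]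

lemma lintegral_mix {Ω : Type*} [MeasurableSpace Ω] (q : ℝ) (Q Q₁ : Measure Ω) (f : Ω → ℝ≥0∞) :
    ∫⁻ x, f x ∂mix q Q Q₁ =
      ENNReal.ofReal (1 - q) * ∫⁻ x, f x ∂Q + ENNReal.ofReal q * ∫⁻ x, f x ∂Q₁ := by
  rw [mix, lintegral_add_measure, lintegral_smul_measure, lintegral_smul_measure, smul_eq_mul,
    smul_eq_mul]

lemma lintegral_bernoulliMeasure (q : unitInterval) (f : Bool → ℝ≥0∞) :
    ∫⁻ x, f x ∂bernoulliMeasure true false q =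
      ENNReal.ofReal (1 - (q : ℝ)) * f false + ENNReal.ofReal (q : ℝ) * f true := by
  rw [bernoulliMeasure_def, lintegral_add_measure, lintegral_smul_measure, lintegral_smul_measure,
    lintegral_dirac, lintegral_dirac, add_comm]
  have h1 : (unitInterval.toNNReal q : ℝ≥0∞) = ENNReal.ofReal (q : ℝ) := by
    rw [ENNReal.ofReal, Real.toNNReal_of_nonneg q.2.1]
    rfl
  have h2 : (unitInterval.toNNReal (unitInterval.symm q) : ℝ≥0∞) =
      ENNReal.ofReal (1 - (q : ℝ)) := by
    rw [ENNReal.ofReal, Real.toNNReal_of_nonneg (sub_nonneg.2 q.2.2)]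
    rfl
  rw [← h1, ← h2]
  rfl

section Round

variable {m n r : ℕ} {Z : Type*}

/-- The law of the LoRA modules after one round, started from `s`. -/
def roundKernel (I : Input m n r Z) (D : FedDataset Z) (s : Mat r n × Mat m r) :
    Measure (Mat r n × Mat m r) :=
  (roundLaw I D).map (globalRound I D s)

instance (I : Input m n r Z) (D : FedDataset Z) : IsProbabilityMeasure (roundLaw I D) := by
  unfold roundLaw
  infer_instance

lemma measurable_roundKernel (I : Input m n r Z) (hℓ : DifferentiableLoss I.ℓ)
    (D : FedDataset Z) : Measurable (roundKernel I D) :=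
  measurable_measure_map (roundLaw I D) (measurable_globalRound I hℓ D)

lemma measurable_globalRound_right (I : Input m n r Z) (hℓ : DifferentiableLoss I.ℓ)
    (D : FedDataset Z) (s : Mat r n × Mat m r) : Measurable (globalRound I D s) := by
  have h : Measurable fun ω : RoundRand m n r I.L D => (s, ω) := measurable_prodMk_left
  have h' := (measurable_globalRound I hℓ D).comp h
  exact h'

lemma measurable_powerDPLaw {α : Type*} [MeasurableSpace α] {W : α → Mat m n} {Q₀ : α → Mat r n}
    (hW : Measurable W) (hQ : Measurable Q₀) (k : ℕ) (s : ℝ) :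
    Measurable fun x => powerDPLaw (W x) k s (Q₀ x) :=
  measurable_measure_map _ (g := fun p : α × (Mat m r × Mat r n) =>
      powerDP (W p.1) k (Q₀ p.1) p.2.1 p.2.2)
    (measurable_powerDP (hW.comp measurable_fst) (hQ.comp measurable_fst) measurable_snd.fst
      measurable_snd.snd k)

lemma lintegral_roundKernel (I : Input m n r Z) (hℓ : DifferentiableLoss I.ℓ) {N : ℕ}
    (F : Fin N → List Z) (s : Mat r n × Mat m r) {f : Mat r n × Mat m r → ℝ≥0∞}
    (hf : Measurable f) :
    ∫⁻ y, f y ∂roundKernel I ⟨N, F⟩ s =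
      ∫⁻ c : Fin N → Bool, ∫⁻ β : (i : Fin N) → Fin I.L → Fin (F i).length → Bool, ∫⁻ Q₀, ∫⁻ y, f y
        ∂powerDPLaw (aggregate I ⟨N, F⟩ c β s) I.k (I.σ * I.C) Q₀ ∂gaussianMatrix r n 1
        ∂(Measure.pi fun _ => Measure.pi fun _ => Measure.pi fun _ =>
          bernoulliMeasure true false I.qs)
        ∂(Measure.pi fun _ => bernoulliMeasure true false I.qc) := by
  have hm := measurable_globalRound_right I hℓ ⟨N, F⟩ s
  have hfm : Measurable fun ω => f (globalRound I ⟨N, F⟩ s ω) := hf.comp hm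
  rw [roundKernel, lintegral_map hf hm, roundLaw, lintegral_prod_four _ _ _ _ hfm]
  refine lintegral_congr fun c => lintegral_congr fun β => lintegral_congr fun Q₀ => ?_
  rw [powerDPLaw, lintegral_map hf (measurable_powerDP measurable_const measurable_const
    measurable_fst measurable_snd _)]
  rfl

/-- A client that is not sampled has no influence on the round. -/
lemma aggregate_insertNth_false (I : Input m n r Z) {N : ℕ} (F : Fin (N + 1) → List Z)
    (i : Fin (N + 1)) (c : Fin N → Bool) (b : Fin I.L → Fin (F i).length → Bool)
    (β : (j : Fin N) → Fin I.L → Fin (F (i.succAbove j)).length → Bool)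
    (s : Mat r n × Mat m r) :
    aggregate I ⟨N + 1, F⟩ (i.insertNth (α := fun _ => Bool) false c)
        (i.insertNth (α := fun j => Fin I.L → Fin (F j).length → Bool) b β) s =
      aggregate I ⟨N, fun j => F (i.succAbove j)⟩ c β s := by
  unfold aggregate
  simp only [Finset.card_filter, Finset.sum_filter]
  rw [Fin.sum_univ_succAbove _ i, Fin.sum_univ_succAbove _ i]
  simp

/-- The randomness shared by a round on a dataset and a round without the `i`-th client: everything
but the coin of the `i`-th client and the noise. -/
abbrev SharedRand {N : ℕ} (r n L : ℕ) (F : Fin (N + 1) → List Z) (i : Fin (N + 1)) : Type :=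
  (Fin N → Bool) × (Fin L → Fin (F i).length → Bool) ×
    ((j : Fin N) → Fin L → Fin (F (i.succAbove j)).length → Bool) × Mat r n

/-- Given the shared randomness, the round without the `i`-th client is PowerDP on some matrix,
and the round with it is a mixture, by the coin of this client, of the same law and PowerDP on
another matrix. -/
lemma roundKernel_eq_bind (I : Input m n r Z) (hℓ : DifferentiableLoss I.ℓ) (hC : 0 < I.C)
    {N : ℕ} (F : Fin (N + 1) → List Z) (i : Fin (N + 1)) (s : Mat r n × Mat m r) :
    ∃ (π : Measure (SharedRand r n I.L F i)) (W₀ W₁ : SharedRand r n I.L F i → Mat m n),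
      IsProbabilityMeasure π ∧ Measurable W₀ ∧ Measurable W₁ ∧
      (∀ ξ, frobNorm (W₀ ξ) ≤ I.C) ∧ (∀ ξ, frobNorm (W₁ ξ) ≤ I.C) ∧
      roundKernel I ⟨N, fun j => F (i.succAbove j)⟩ s =
        π.bind (fun ξ => powerDPLaw (W₀ ξ) I.k (I.σ * I.C) ξ.2.2.2) ∧
      roundKernel I ⟨N + 1, F⟩ s =
        π.bind (fun ξ => mix I.qc (powerDPLaw (W₀ ξ) I.k (I.σ * I.C) ξ.2.2.2)
          (powerDPLaw (W₁ ξ) I.k (I.σ * I.C) ξ.2.2.2)) := by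
  set D : FedDataset Z := ⟨N + 1, F⟩
  set D' : FedDataset Z := ⟨N, fun j => F (i.succAbove j)⟩
  let πb : Measure (Fin I.L → Fin (F i).length → Bool) := Measure.pi fun _ =>
    Measure.pi fun _ => bernoulliMeasure true false I.qs
  let πc : Measure (Fin N → Bool) := Measure.pi fun _ => bernoulliMeasure true false I.qc
  let πβ : Measure ((j : Fin N) → Fin I.L → Fin (F (i.succAbove j)).length → Bool) :=
    Measure.pi fun _ => Measure.pi fun _ => Measure.pi fun _ => bernoulliMeasure true false I.qs
  have : IsProbabilityMeasure πb := by unfold πb; infer_instance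
  have : IsProbabilityMeasure πc := by unfold πc; infer_instance
  have : IsProbabilityMeasure πβ := by unfold πβ; infer_instance
  let g₀ : (Fin N → Bool) × (Fin I.L → Fin (F i).length → Bool) ×
    ((j : Fin N) → Fin I.L → Fin (F (i.succAbove j)).length → Bool) → Mat m n :=
    fun ξ => aggregate I D' ξ.1 ξ.2.2 s
  let g₁ : (Fin N → Bool) × (Fin I.L → Fin (F i).length → Bool) ×
    ((j : Fin N) → Fin I.L → Fin (F (i.succAbove j)).length → Bool) → Mat m n :=
    fun ξ => aggregate I D (i.insertNth (α := fun _ => Bool) true ξ.1)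
      (i.insertNth (α := fun j => Fin I.L → Fin (F j).length → Bool) ξ.2.1 ξ.2.2) s
  have hπ : Measurable fun ξ : SharedRand r n I.L F i => (ξ.1, ξ.2.1, ξ.2.2.1) := by fun_prop
  have hW₀ : Measurable fun ξ : SharedRand r n I.L F i => g₀ (ξ.1, ξ.2.1, ξ.2.2.1) :=
    (Measurable.of_discrete (f := g₀)).comp hπ
  have hW₁ : Measurable fun ξ : SharedRand r n I.L F i => g₁ (ξ.1, ξ.2.1, ξ.2.2.1) :=
    (Measurable.of_discrete (f := g₁)).comp hπ
  have hQ : Measurable fun ξ : SharedRand r n I.L F i => ξ.2.2.2 := by fun_prop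
  have hK₀ := measurable_powerDPLaw hW₀ hQ I.k (I.σ * I.C)
  have hK₁ := measurable_powerDPLaw hW₁ hQ I.k (I.σ * I.C)
  refine ⟨πc.prod (πb.prod (πβ.prod (gaussianMatrix r n 1))), _, _, inferInstance, hW₀, hW₁,
    fun ξ => frobNorm_aggregate_le I hC _ _ _ _, fun ξ => frobNorm_aggregate_le I hC _ _ _ _,
    ?_, ?_⟩
  · refine Measure.ext_of_lintegral _ fun f hf => ?_
    have hm := (Measure.measurable_lintegral hf).comp hK₀
    simp only [Function.comp_def] at hm
    rw [Measure.lintegral_bind hK₀.aemeasurable hf.aemeasurable,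
      lintegral_prod_four _ _ _ _ hm, lintegral_roundKernel I hℓ _ _ hf]
    refine lintegral_congr fun c => ?_
    -- The batches of the removed client are integrated out.
    exact ((lintegral_const (μ := πb) _).trans (by rw [measure_univ, mul_one])).symm
  · refine Measure.ext_of_lintegral _ fun f hf => ?_
    have hmix := measurable_mix I.qc hK₀ hK₁
    have hm := (Measure.measurable_lintegral hf).comp hmix
    simp only [Function.comp_def] at hm
    rw [Measure.lintegral_bind hmix.aemeasurable hf.aemeasurable,
      lintegral_prod_four _ _ _ _ hm, lintegral_roundKernel I hℓ _ _ hf,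
      lintegral_pi_succAbove _ i (Measurable.of_discrete), lintegral_bernoulliMeasure,
      ← lintegral_linear _ _ _ Measurable.of_discrete Measurable.of_discrete]
    refine lintegral_congr fun c => ?_
    rw [lintegral_pi_succAbove _ i (Measurable.of_discrete),
      lintegral_pi_succAbove _ i (Measurable.of_discrete),
      ← lintegral_linear _ _ _ Measurable.of_discrete Measurable.of_discrete]
    refine lintegral_congr fun b => ?_
    rw [← lintegral_linear _ _ _ Measurable.of_discrete Measurable.of_discrete]
    refine lintegral_congr fun β => ?_
    have hA : ∀ W : Mat m n, Measurable fun Q₀ : Mat r n =>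
        ∫⁻ y, f y ∂powerDPLaw W I.k (I.σ * I.C) Q₀ := fun W =>
      (Measure.measurable_lintegral hf).comp
        (measurable_powerDPLaw measurable_const measurable_id I.k (I.σ * I.C))
    rw [← lintegral_linear _ _ _ (hA _) (hA _)]
    refine lintegral_congr fun Q₀ => ?_
    rw [lintegral_mix, aggregate_insertNth_false]

end Round

section Rounds

variable {m n r : ℕ} {Z : Type*}

/-- One round of subsampled PowerDP: adding or removing one client costs `56 qc² l / σ²` at order
`l`. -/
lemma holderDom_roundKernel (I : Input m n r Z) (hℓ : DifferentiableLoss I.ℓ) (hk : 1 ≤ I.k)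
    (hC : 0 < I.C) (hσ : 0 < I.σ) (hq : (I.qc : ℝ) < 1) {p : ℝ} {l : ℕ}
    (hpl : p.HolderConjugate l) (hl : 32 * l ≤ I.σ ^ 2) {N : ℕ} (F : Fin (N + 1) → List Z)
    (i : Fin (N + 1)) (s : Mat r n × Mat m r) :
    HolderDom p (ENNReal.ofReal (Real.exp (56 * (I.qc : ℝ) ^ 2 * l / I.σ ^ 2)))
        (roundKernel I ⟨N + 1, F⟩ s) (roundKernel I ⟨N, fun j => F (i.succAbove j)⟩ s) ∧
      HolderDom p (ENNReal.ofReal (Real.exp (56 * (I.qc : ℝ) ^ 2 * l / I.σ ^ 2)))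
        (roundKernel I ⟨N, fun j => F (i.succAbove j)⟩ s) (roundKernel I ⟨N + 1, F⟩ s) := by
  obtain ⟨π, W₀, W₁, hπ, hm₀, hm₁, hW₀, hW₁, h', h⟩ := roundKernel_eq_bind I hℓ hC F i s
  have hQ : Measurable fun ξ : SharedRand r n I.L F i => ξ.2.2.2 := by fun_prop
  have hK₀ := measurable_powerDPLaw hm₀ hQ I.k (I.σ * I.C)
  have hK := measurable_mix I.qc hK₀ (measurable_powerDPLaw hm₁ hQ I.k (I.σ * I.C))
  have hone := HolderDom.refl hpl π
  have key : ∀ ξ : SharedRand r n I.L F i,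
      HolderDom p (ENNReal.ofReal (Real.exp (56 * (I.qc : ℝ) ^ 2 * l / I.σ ^ 2)))
        (mix I.qc (powerDPLaw (W₀ ξ) I.k (I.σ * I.C) ξ.2.2.2)
          (powerDPLaw (W₁ ξ) I.k (I.σ * I.C) ξ.2.2.2))
        (powerDPLaw (W₀ ξ) I.k (I.σ * I.C) ξ.2.2.2) ∧
      HolderDom p (ENNReal.ofReal (Real.exp (56 * (I.qc : ℝ) ^ 2 * l / I.σ ^ 2)))
        (powerDPLaw (W₀ ξ) I.k (I.σ * I.C) ξ.2.2.2)
        (mix I.qc (powerDPLaw (W₀ ξ) I.k (I.σ * I.C) ξ.2.2.2)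
          (powerDPLaw (W₁ ξ) I.k (I.σ * I.C) ξ.2.2.2)) := by
    intro ξ
    obtain ⟨θ, Q, Q', f, hf, hθ0, hθ, hshift, e₀, e₁⟩ :=
      exists_shift_powerDPLaw hk hσ hC (hW₀ ξ) (hW₁ ξ) ξ.2.2.2 ξ.2.2.2
    have hσ2 : 0 < I.σ ^ 2 := by positivity
    have hl0 : (0 : ℝ) ≤ l := l.cast_nonneg
    have hθl : 8 * θ * l ≤ 1 := by
      have h1 : θ * I.σ ^ 2 ≤ 4 := (le_div_iff₀ hσ2).1 hθ
      have h2 : 8 * θ * l * I.σ ^ 2 ≤ 1 * I.σ ^ 2 := by nlinarith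
      exact le_of_mul_le_mul_right h2 hσ2
    have hle : ENNReal.ofReal (Real.exp (14 * (I.qc : ℝ) ^ 2 * θ * l)) ≤
        ENNReal.ofReal (Real.exp (56 * (I.qc : ℝ) ^ 2 * l / I.σ ^ 2)) := by
      refine ENNReal.ofReal_le_ofReal (Real.exp_le_exp.2 ?_)
      calc 14 * (I.qc : ℝ) ^ 2 * θ * l ≤ 14 * (I.qc : ℝ) ^ 2 * (4 / I.σ ^ 2) * l := by gcongr
        _ = _ := by ring
    rw [e₀, e₁, mix_map _ _ _ hf]
    have hq0 : (0 : ℝ) ≤ I.qc := I.qc.2.1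
    exact ⟨((hshift.holderDom_mix_left hpl hθ0 hq0 hq.le (by nlinarith)).map hf).mono hle,
      ((hshift.holderDom_mix_right hpl hθ0 hq0 hq hθl).map hf).mono hle⟩
  rw [h, h']
  constructor
  · simpa using hone.bind hpl.pos hK hK₀ fun ξ => (key ξ).1
  · simpa using hone.bind hpl.pos hK₀ hK fun ξ => (key ξ).2

/-! ### All rounds -/

lemma stateLaw_succ (I : Input m n r Z) (hℓ : DifferentiableLoss I.ℓ) (D : FedDataset Z) (t : ℕ) :
    stateLaw I D (t + 1) = (stateLaw I D t).bind (roundKernel I D) := by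
  refine Measure.ext_of_lintegral _ fun f hf => ?_
  have hm := measurable_globalRound I hℓ D
  have hfm : Measurable fun p : (Mat r n × Mat m r) × RoundRand m n r I.L D =>
      f (globalRound I D p.1 p.2) := hf.comp hm
  rw [stateLaw, lintegral_map hf hm, lintegral_prod _ hfm.aemeasurable,
    Measure.lintegral_bind (measurable_roundKernel I hℓ D).aemeasurable hf.aemeasurable]
  refine lintegral_congr fun s => ?_
  rw [roundKernel, lintegral_map hf (measurable_globalRound_right I hℓ D s)]

lemma isProbabilityMeasure_stateLaw (I : Input m n r Z) (hℓ : DifferentiableLoss I.ℓ)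
    (D : FedDataset Z) (t : ℕ) : IsProbabilityMeasure (stateLaw I D t) := by
  induction t with
  | zero =>
    unfold stateLaw
    infer_instance
  | succ t ih =>
    unfold stateLaw
    exact Measure.isProbabilityMeasure_map (measurable_globalRound I hℓ D).aemeasurable

lemma holderDom_stateLaw (I : Input m n r Z) (hℓ : DifferentiableLoss I.ℓ) {D D' : FedDataset Z}
    {p l b : ℝ} (hpl : p.HolderConjugate l)
    (h : ∀ s, HolderDom p (ENNReal.ofReal (Real.exp b)) (roundKernel I D s) (roundKernel I D' s))
    (t : ℕ) :
    HolderDom p (ENNReal.ofReal (Real.exp (t * b))) (stateLaw I D t) (stateLaw I D' t) := by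
  induction t with
  | zero =>
    have := isProbabilityMeasure_stateLaw I hℓ D' 0
    have e : stateLaw I D 0 = stateLaw I D' 0 := rfl
    rw [e]
    simpa using HolderDom.refl hpl (stateLaw I D' 0)
  | succ t ih =>
    rw [stateLaw_succ I hℓ, stateLaw_succ I hℓ]
    refine (ih.bind hpl.pos (measurable_roundKernel I hℓ D) (measurable_roundKernel I hℓ D')
      h).mono (le_of_eq ?_)
    rw [← ENNReal.ofReal_mul (Real.exp_pos _).le, ← Real.exp_add]
    congr 2
    push_cast
    ring

/-- The law after at least one round is an average of output laws of PowerDP on matrices of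
Frobenius norm at most `C`. -/
lemma stateLaw_succ_apply_mem_Icc (I : Input m n r Z) (hℓ : DifferentiableLoss I.ℓ) (hC : 0 < I.C)
    (D : FedDataset Z) (t : ℕ) {S : Set (Mat r n × Mat m r)} (hS : MeasurableSet S)
    {lo hi : ℝ≥0∞} (h : ∀ W Q₀, frobNorm W ≤ I.C →
      powerDPLaw (m := m) W I.k (I.σ * I.C) Q₀ S ∈ Set.Icc lo hi) :
    stateLaw I D (t + 1) S ∈ Set.Icc lo hi := by
  have := isProbabilityMeasure_stateLaw I hℓ D t
  have hav : ∀ {α : Type _} [MeasurableSpace α] (μ : Measure α) [IsProbabilityMeasure μ]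
      {g : α → ℝ≥0∞}, (∀ x, g x ∈ Set.Icc lo hi) → ∫⁻ x, g x ∂μ ∈ Set.Icc lo hi := by
    intro α _ μ _ g hg
    constructor
    · simpa using lintegral_mono (μ := μ) fun x => (hg x).1
    · simpa using lintegral_mono (μ := μ) fun x => (hg x).2
  rw [stateLaw_succ I hℓ, Measure.bind_apply hS (measurable_roundKernel I hℓ D).aemeasurable]
  refine hav _ fun s => ?_
  obtain ⟨N, F⟩ := D
  rw [← lintegral_indicator_one hS,
    lintegral_roundKernel I hℓ F s (measurable_one.indicator hS)]
  refine hav _ fun c => hav _ fun β => hav _ fun Q₀ => ?_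
  rw [lintegral_indicator_one hS]
  exact h _ _ (frobNorm_aggregate_le I hC _ _ _ _)

/-- Privacy of the last round alone: whatever the two datasets are, the last call of PowerDP hides
them. -/
lemma stateLaw_succ_le_of_gaussian (I : Input m n r Z) (hℓ : DifferentiableLoss I.ℓ) (hk : 1 ≤ I.k)
    (hC : 0 < I.C) (hσ : 0 < I.σ) {l : ℕ} (hl : 1 < l) {ε δ : ℝ} (hδ : 0 < δ)
    (h : 4 * (l : ℝ) ^ 2 / I.σ ^ 2 + Real.log (1 / δ) ≤ ε * (l - 1)) (D D' : FedDataset Z) (t : ℕ)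
    {S : Set (Mat r n × Mat m r)} (hS : MeasurableSet S) :
    stateLaw I D (t + 1) S ≤
      ENNReal.ofReal (Real.exp ε) * stateLaw I D' (t + 1) S + ENNReal.ofReal δ := by
  have hl1 : (1 : ℝ) < l := by exact_mod_cast hl
  have key : ∀ (W W' : Mat m n) (Q₀ Q₀' : Mat r n), frobNorm W ≤ I.C → frobNorm W' ≤ I.C →
      powerDPLaw W I.k (I.σ * I.C) Q₀ S ≤
        ENNReal.ofReal (Real.exp ε) * powerDPLaw W' I.k (I.σ * I.C) Q₀' S + ENNReal.ofReal δ := by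
    intro W W' Q₀ Q₀' hW hW'
    obtain ⟨θ, Q, Q', f, hf, hθ0, hθ, hshift, e₀, e₁⟩ :=
      exists_shift_powerDPLaw hk hσ hC hW' hW Q₀' Q₀
    have hpl := (Real.HolderConjugate.conjExponent hl1).symm
    rw [e₀, e₁]
    refine HolderDom.measure_le hpl hδ ((hshift.holderDom hpl).map hf) (le_trans ?_ h) hS
    gcongr
    calc θ * (l - 1) * l ≤ θ * l * l := by gcongr; linarith
      _ ≤ 4 / I.σ ^ 2 * l * l := by gcongr
      _ = _ := by ring
  have h1 : ∀ (W' : Mat m n) (Q₀' : Mat r n), frobNorm W' ≤ I.C → stateLaw I D (t + 1) S ≤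
      ENNReal.ofReal (Real.exp ε) * powerDPLaw W' I.k (I.σ * I.C) Q₀' S + ENNReal.ofReal δ :=
    fun W' Q₀' hW' => (stateLaw_succ_apply_mem_Icc I hℓ hC D t hS (lo := 0) fun W Q₀ hW =>
      ⟨zero_le, key W W' Q₀ Q₀' hW hW'⟩).2
  have he0 : ENNReal.ofReal (Real.exp ε) ≠ 0 := by simpa using Real.exp_pos ε
  have h2 := (stateLaw_succ_apply_mem_Icc I hℓ hC D' t hS (hi := ⊤)
    (lo := (stateLaw I D (t + 1) S - ENNReal.ofReal δ) / ENNReal.ofReal (Real.exp ε))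
    fun W Q₀ hW => ⟨ENNReal.div_le_of_le_mul' (tsub_le_iff_right.2 (h1 W Q₀ hW)), le_top⟩).1
  rw [ENNReal.div_le_iff_le_mul (Or.inl he0) (Or.inl ENNReal.ofReal_ne_top),
    tsub_le_iff_right, mul_comm] at h2
  exact h2

/-- Privacy by composition of the subsampled rounds. -/
lemma stateLaw_le_of_subsampling (I : Input m n r Z) (hℓ : DifferentiableLoss I.ℓ) (hk : 1 ≤ I.k)
    (hC : 0 < I.C) (hσ : 0 < I.σ) (hq : (I.qc : ℝ) < 1) {l : ℕ} (hl : 1 < l)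
    (hlσ : 32 * l ≤ I.σ ^ 2) {ε δ : ℝ} (hδ : 0 < δ) {t : ℕ}
    (h : 56 * (I.qc : ℝ) ^ 2 * t * l ^ 2 / I.σ ^ 2 + Real.log (1 / δ) ≤ ε * (l - 1))
    {D D' : FedDataset Z} (hD : ClientAdjacent D D')
    {S : Set (Mat r n × Mat m r)} (hS : MeasurableSet S) :
    stateLaw I D t S ≤ ENNReal.ofReal (Real.exp ε) * stateLaw I D' t S + ENNReal.ofReal δ := by
  have hl1 : (1 : ℝ) < l := by exact_mod_cast hl
  have hpl := (Real.HolderConjugate.conjExponent hl1).symm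
  have hround : ∀ {D D' : FedDataset Z}, AddsClient D D' → ∀ s,
      HolderDom (Real.conjExponent l) (ENNReal.ofReal (Real.exp (56 * (I.qc : ℝ) ^ 2 * l / I.σ ^ 2)))
        (roundKernel I D s) (roundKernel I D' s) ∧
      HolderDom (Real.conjExponent l) (ENNReal.ofReal (Real.exp (56 * (I.qc : ℝ) ^ 2 * l / I.σ ^ 2)))
        (roundKernel I D' s) (roundKernel I D s) := by
    rintro D D' ⟨N, E, i, d, rfl, rfl⟩ s
    have := holderDom_roundKernel I hℓ hk hC hσ hq hpl hlσ
      (i.insertNth (α := fun _ => List Z) d E) i s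
    simpa only [Fin.insertNth_apply_succAbove] using this
  have hcost : t * (56 * (I.qc : ℝ) ^ 2 * l / I.σ ^ 2) * l + Real.log (1 / δ) ≤ ε * (l - 1) := by
    refine le_trans (le_of_eq ?_) h
    ring
  rcases hD with hD | hD
  · exact (holderDom_stateLaw I hℓ hpl (fun s => (hround hD s).1) t).measure_le hpl hδ hcost hS
  · exact (holderDom_stateLaw I hℓ hpl (fun s => (hround hD s).2) t).measure_le hpl hδ hcost hS

end Rounds

/-! ### Choice of the order and of the constant -/

/-- The order `2 + ⌈2 L / ε⌉` at which the Rényi divergences are used. -/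
lemma exists_order {ε L : ℝ} (hε : 0 < ε) (hL : 0 < L) :
    ∃ l : ℕ, 1 < l ∧ ε + 2 * L ≤ ε * (l - 1) ∧ ε * l ≤ 3 * ε + 2 * L := by
  refine ⟨2 + ⌈2 * L / ε⌉₊, by omega, ?_, ?_⟩
  · have h := (div_le_iff₀ hε).1 (Nat.le_ceil (2 * L / ε))
    push_cast
    linarith
  · have h := (Nat.ceil_lt_add_one (by positivity : 0 ≤ 2 * L / ε)).le
    have h' := mul_le_mul_of_nonneg_left h hε.le
    rw [mul_add, mul_div_cancel₀ _ hε.ne'] at h'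
    push_cast
    linarith

/-- The budget of a single Gaussian round, in the case `K = c² q² T ≥ 64`. -/
lemma gaussian_budget {c K L L₀ ε σ l : ℝ} (hc : 0 < c) (hcL₀ : 72 ≤ c * L₀) (hL : 0 < L)
    (hLL₀ : L₀ ≤ L) (hε : 0 < ε) (hσ : 0 < σ) (hKσ : K * L ≤ σ ^ 2 * ε ^ 2) (hεK : c * ε < K)
    (hK : 64 ≤ K) (hl0 : 0 ≤ l) (hl1 : ε + 2 * L ≤ ε * (l - 1)) (hl2 : ε * l ≤ 3 * ε + 2 * L) :
    4 * l ^ 2 / σ ^ 2 + L ≤ ε * (l - 1) := by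
  have hε2 : 0 < ε ^ 2 := by positivity
  suffices 4 * l ^ 2 / σ ^ 2 ≤ ε + L by linarith
  rw [div_le_iff₀ (by positivity)]
  refine le_of_mul_le_mul_right ?_ hε2
  have h1 : (ε * l) ^ 2 ≤ (3 * ε + 2 * L) ^ 2 := by gcongr
  have h2 : 72 * ε ≤ K * L := by
    have h3 : 72 * ε ≤ c * L * ε :=
      mul_le_mul_of_nonneg_right (hcL₀.trans (mul_le_mul_of_nonneg_left hLL₀ hc.le)) hε.le
    have h4 := mul_le_mul_of_nonneg_right hεK.le hL.le
    linarith
  have h3 : 72 * ε ^ 2 + 32 * L ^ 2 ≤ (ε + L) * (K * L) := by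
    have h5 := mul_le_mul_of_nonneg_left h2 hε.le
    have h6 := mul_le_mul_of_nonneg_right hK (sq_nonneg L)
    linarith [sq_nonneg L]
  have h4 : (ε + L) * (K * L) ≤ (ε + L) * (σ ^ 2 * ε ^ 2) :=
    mul_le_mul_of_nonneg_left hKσ (by positivity)
  linarith [sq_nonneg (3 * ε - 2 * L)]

/-- The budget of `T` subsampled rounds, in the case `K = c² q² T < 64`. -/
lemma subsampling_budget {c K L ε σ l w : ℝ} (hc : 160 ≤ c) (hL : 0 < L) (hε : 0 < ε)
    (hσ : 0 < σ) (hw : 0 ≤ w) (hKw : K = c ^ 2 * w) (hKσ : K * L ≤ σ ^ 2 * ε ^ 2)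
    (hεK : c * ε < K) (hεL : ε ≤ L) (hl0 : 0 ≤ l) (hl1 : ε + 2 * L ≤ ε * (l - 1))
    (hl2 : ε * l ≤ 3 * ε + 2 * L) :
    32 * l ≤ σ ^ 2 ∧ 56 * w * l ^ 2 / σ ^ 2 + L ≤ ε * (l - 1) := by
  have hε2 : 0 < ε ^ 2 := by positivity
  have hl5 : ε * l ≤ 5 * L := by linarith
  constructor
  · refine le_of_mul_le_mul_right ?_ hε2
    have h1 := mul_le_mul_of_nonneg_left hl5 hε.le
    have h2 := mul_le_mul_of_nonneg_right hc hε.le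
    have h3 := mul_le_mul_of_nonneg_right (h2.trans hεK.le) hL.le
    linarith
  · suffices 56 * w * l ^ 2 / σ ^ 2 ≤ L by linarith
    rw [div_le_iff₀ (by positivity)]
    refine le_of_mul_le_mul_right ?_ hε2
    have h1 : (ε * l) ^ 2 ≤ (5 * L) ^ 2 := by gcongr
    have h2 := mul_le_mul_of_nonneg_left h1 hw
    have h3 : 1400 ≤ c ^ 2 := (by norm_num : (1400 : ℝ) ≤ 160 ^ 2).trans (by gcongr)
    have h4 := mul_le_mul_of_nonneg_right h3 (mul_nonneg hw (sq_nonneg L))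
    have h5 := mul_le_mul_of_nonneg_left hKσ hL.le
    rw [hKw] at h5
    linarith

end FedPower

end

theorem mainTheorem4 (δ₀ : ℝ) (hδ₀ : δ₀ < 1) :
    ∃ c : ℝ, 0 < c ∧
      ∀ (m n r : ℕ) (Z : Type*) (I : FedPower.Input m n r Z),
        FedPower.DifferentiableLoss I.ℓ → 1 ≤ I.k → 0 < I.C →
        ∀ ε δ : ℝ, 0 < ε → ε < c * (I.qc : ℝ) ^ 2 * I.T → 0 < δ → δ ≤ δ₀ →
          c * ((I.qc : ℝ) * √(I.T * Real.log (1 / δ)) / ε) ≤ I.σ →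
          FedPower.IsClientLevelDP (FedPower.mechanism I) ε δ := by
  set L₀ := Real.log (1 / max δ₀ (1 / 2)) with hL₀def
  have hd0 : 0 < max δ₀ (1 / 2) := lt_max_of_lt_right (by norm_num)
  have hL₀ : 0 < L₀ := Real.log_pos (one_lt_one_div hd0 (max_lt hδ₀ (by norm_num)))
  refine ⟨160 + 72 / L₀, by positivity, ?_⟩
  intro m n r Z I hℓ hk hC ε δ hε hεc hδ hδδ₀ hσc
  set c := 160 + 72 / L₀ with hc
  have hc160 : 160 ≤ c := by
    have : 0 < 72 / L₀ := by positivity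
    linarith
  have hc0 : 0 < c := by linarith
  have hcL₀ : 72 ≤ c * L₀ := by
    rw [hc, add_mul, div_mul_cancel₀ _ hL₀.ne']
    linarith
  clear_value c
  set L := Real.log (1 / δ) with hL
  have hLL₀ : L₀ ≤ L := Real.log_le_log (by positivity)
    (one_div_le_one_div_of_le hδ (hδδ₀.trans (le_max_left _ _)))
  have hLpos : 0 < L := hL₀.trans_le hLL₀
  set q : ℝ := (I.qc : ℝ)
  have hq0 : 0 ≤ q := I.qc.2.1
  have hTpos : I.T ≠ 0 := by
    intro h
    rw [h] at hεc
    simp only [Nat.cast_zero, mul_zero] at hεc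
    linarith
  have hT1 : (1 : ℝ) ≤ I.T := by exact_mod_cast Nat.one_le_iff_ne_zero.2 hTpos
  have hqpos : 0 < q := by
    refine hq0.lt_of_ne fun h => ?_
    rw [← h] at hεc
    norm_num at hεc
    linarith
  have hσpos : 0 < I.σ := lt_of_lt_of_le (by positivity) hσc
  -- In terms of `K = c² q² T`, the two hypotheses read `K L ≤ σ² ε²` and `c ε < K`.
  set K := c ^ 2 * q ^ 2 * I.T with hK
  have hK0 : 0 < K := by positivity
  have hKσ : K * L ≤ I.σ ^ 2 * ε ^ 2 := by
    have h1 : c * q * √(I.T * L) ≤ I.σ * ε := by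
      have := mul_le_mul_of_nonneg_right hσc hε.le
      rwa [← mul_div_assoc, div_mul_cancel₀ _ hε.ne', ← mul_assoc] at this
    have h2 := pow_le_pow_left₀ (by positivity) h1 2
    rw [mul_pow, mul_pow, mul_pow, Real.sq_sqrt (by positivity)] at h2
    linarith
  have hεK : c * ε < K := by
    have := mul_lt_mul_of_pos_left hεc hc0
    rw [hK]
    linarith
  obtain ⟨l, hl, hl1, hl2⟩ := FedPower.exists_order hε hLpos
  have hl0 : (0 : ℝ) ≤ l := l.cast_nonneg
  have hout : Measurable fun s : FedPower.Mat r n × FedPower.Mat m r => I.W₀ + s.2 * s.1 :=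
    FedPower.measurable_mat_add measurable_const
      (FedPower.measurable_mat_mul measurable_snd measurable_fst)
  refine ⟨fun D => ?_, fun D D' hD S hS => ?_⟩
  · have := FedPower.isProbabilityMeasure_stateLaw I hℓ D I.T
    exact Measure.isProbabilityMeasure_map hout.aemeasurable
  rw [FedPower.mechanism, FedPower.mechanism, Measure.map_apply hout hS,
    Measure.map_apply hout hS]
  rcases le_or_gt 64 K with hK64 | hK64
  · obtain ⟨t, ht⟩ := Nat.exists_eq_succ_of_ne_zero hTpos
    rw [ht]
    exact FedPower.stateLaw_succ_le_of_gaussian I hℓ hk hC hσpos hl hδ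
      (FedPower.gaussian_budget hc0 hcL₀ hLpos hLL₀ hε hσpos hKσ hεK hK64 hl0 hl1 hl2) D D' t
      (hout hS)
  · have hεL : ε ≤ L := by
      have : c * ε ≤ c * L₀ := by linarith
      exact (le_of_mul_le_mul_left this hc0).trans hLL₀
    have hq1 : q < 1 := by
      by_contra! h
      have : (160 : ℝ) ^ 2 * 1 ^ 2 * 1 ≤ K := by rw [hK]; gcongr
      linarith
    obtain ⟨h1, h2⟩ := FedPower.subsampling_budget (w := q ^ 2 * I.T) hc160 hLpos hε hσpos
      (by positivity) (by rw [hK]; ring) hKσ hεK hεL hl0 hl1 hl2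
    refine FedPower.stateLaw_le_of_subsampling I hℓ hk hC hσpos hq1 hl h1 hδ ?_ hD (hout hS)
    rwa [mul_assoc 56]
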